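/- Let $K$ be a field and let $Q$ be a strongly locally finite quiver (every vertex is the source of only finitely many arrows and the target of only finitely many arrows, and there are only finitely many paths between any two vertices). Let $*$ be a source of $Q$ (no arrow ends at $*$). Let $I$ be the ideal of the path category generated by a set of relations (finite $K$-linear combinations of parallel paths of length at least $2$), none of which starts at $*$. Let $\mathcal C=K\mathcal Q/\mathcal I$ be the additive path category of $Q$ modulo $I$ (objects: finite direct sums of vertices; morphisms: matrices of elements of $KQ/I$). Put $\mathcal U=\mathrm{add}\{q\in Q_0 : q\neq *\}$, $\mathcal T=\mathrm{add}\{*\}$, $M(U,T)=\mathcal C(T,U)$, and let $\Lambda=\begin{pmatrix}\mathcal T&0\\ M&\mathcal U\end{pmatrix}$ be the triangular matrix category: its objects are the matrices $\begin{pmatrix}T&0\\ M&U\end{pmatrix}$ with $T\in\mathcal T$ and $U\in\mathcal U$, its morphisms are the matrices $\begin{pmatrix}f&0\\ m&g\end{pmatrix}$ with $f\in\mathcal T(T,T')$, $m\in M(U',T)$, $g\in\mathcal U(U,U')$, composed by matrix multiplication. For a $K$-category $\mathcal A$ let $\mathrm{Mod}\,\mathcal A$ be the abelian category of covariant $K$-linear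 functors from $\mathcal A$ to $K$-vector spaces, and $\mathrm{mod}\,\mathcal A$ its full subcategory of finitely presented functors; $\mathrm{Ext}^j_{\mathcal A}$ denotes $\mathrm{Ext}^j$ in $\mathrm{Mod}\,\mathcal A$. Let $\mathcal R:\mathrm{Mod}\,\Lambda\to\mathrm{Mod}\,\mathcal U$ be the exact restriction functor $(\mathcal RF)(U)=F\begin{pmatrix}0&0\\ M&U\end{pmatrix}$. Let $P=\Lambda\left(\begin{pmatrix}*&0\\ M&0\end{pmatrix},-\right)$, let $S=P/\mathrm{rad}\,P$, and let $S^{\mathrm{perp}}$ be the class of pointwise finite-dimensional $\Lambda$-modules $Y$ with $\mathrm{Hom}_\Lambda(S,Y)=0$ and $\mathrm{Ext}^1_\Lambda(S,Y)=0$. Let $X$ and $Y$ be in $\mathrm{mod}\,\Lambda$. Then the $K$-linear maps $\mathrm{Ext}^j_\Lambda(X,Y)\to\mathrm{Ext}^j_{\mathcal U}(\mathcal RX,\mathcal RY)$ induced by the exact functor $\mathcal R$ have the following properties. (a) For $j=1$ the map $\mathrm{Ext}^1_\Lambda(X,Y)\to\mathrm{Ext}^1_{\mathcal U}(\mathcal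 RX,\mathcal RY)$ is an epimorphism. (b) For each $j\ge 2$ the map $\mathrm{Ext}^j_\Lambda(X,Y)\to\mathrm{Ext}^j_{\mathcal U}(\mathcal RX,\mathcal RY)$ is an isomorphism. (c) If $Y\in S^{\mathrm{perp}}$, then the epimorphism of (a) is an isomorphism. -/

import Mathlib

open CategoryTheory CategoryTheory.Limits Opposite
open scoped ZeroObject

universe u v

namespace OnePointExt

noncomputable section

/-! ### Modules over a `K`-category -/

section Modules

variable (K : Type v) [Field K] (C : Type u) [Category.{v} C] [Preadditive C] [Linear K C]

/-- The property of a functor `C ⥤ Mod K` of being additive and `K`-linear. -/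
def isLinear : ObjectProperty (C ⥤ ModuleCat.{v} K) :=
  fun F => F.Additive ∧ F.Linear K

/-- `Mod C`: the category of (left) modules over the `K`-category `C`, that is of covariant
`K`-linear functors from `C` to `K`-vector spaces. -/
abbrev Mod : Type (max u (v + 1)) := (isLinear K C).FullSubcategory

variable {K C}

instance (F : Mod K C) : F.obj.Additive := F.property.1

instance (F : Mod K C) : F.obj.Linear K := F.property.2

lemma isLinear_of_isLimit {J : Type} [Category.{0} J] {D : J ⥤ C ⥤ ModuleCat.{v} K} {c : Cone D}
    (hc : IsLimit c) (hD : ∀ j, isLinear K C (D.obj j)) : isLinear K C c.pt := by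
  have key (Y : C) := isLimitOfPreserves ((evaluation C (ModuleCat.{v} K)).obj Y) hc
  constructor
  · refine ⟨fun {X Y f g} => (key Y).hom_ext fun j => ?_⟩
    have := (hD j).1
    change c.pt.map (f + g) ≫ (c.π.app j).app Y = (c.pt.map f + c.pt.map g) ≫ (c.π.app j).app Y
    simp [Preadditive.add_comp, (D.obj j).map_add]
  · refine ⟨fun {X Y} f r => (key Y).hom_ext fun j => ?_⟩
    have := (hD j).1
    have := (hD j).2
    change c.pt.map (r • f) ≫ (c.π.app j).app Y = (r • c.pt.map f) ≫ (c.π.app j).app Y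
    simp [Functor.map_smul]

lemma isLinear_of_isColimit {J : Type} [Category.{0} J] {D : J ⥤ C ⥤ ModuleCat.{v} K}
    {c : Cocone D} (hc : IsColimit c) (hD : ∀ j, isLinear K C (D.obj j)) :
    isLinear K C c.pt := by
  have key (X : C) := isColimitOfPreserves ((evaluation C (ModuleCat.{v} K)).obj X) hc
  constructor
  · refine ⟨fun {X Y f g} => (key X).hom_ext fun j => ?_⟩
    have := (hD j).1
    change (c.ι.app j).app X ≫ c.pt.map (f + g) = (c.ι.app j).app X ≫ (c.pt.map f + c.pt.map g)
    have n {h : X ⟶ Y} : (D.obj j).map h ≫ (c.ι.app j).app Y = (c.ι.app j).app X ≫ c.pt.map h :=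
      (c.ι.app j).naturality h
    rw [Preadditive.comp_add, ← n, ← n, ← n, (D.obj j).map_add, Preadditive.add_comp]
  · refine ⟨fun {X Y} f r => (key X).hom_ext fun j => ?_⟩
    have := (hD j).1
    have := (hD j).2
    change (c.ι.app j).app X ≫ c.pt.map (r • f) = (c.ι.app j).app X ≫ (r • c.pt.map f)
    have n {h : X ⟶ Y} : (D.obj j).map h ≫ (c.ι.app j).app Y = (c.ι.app j).app X ≫ c.pt.map h :=
      (c.ι.app j).naturality h
    rw [Linear.comp_smul, ← n, ← n, Functor.map_smul, Linear.smul_comp]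

instance : (isLinear K C).IsClosedUnderFiniteProducts where
  isClosedUnderLimitsOfShape J _ :=
    { limitsOfShape_le := by
        rintro F ⟨p⟩
        exact isLinear_of_isLimit p.isLimit p.prop_diag_obj }

instance : (isLinear K C).IsClosedUnderKernels where
  kernels_le := by
    rintro _ ⟨f, k, hk, hf⟩
    exact isLinear_of_isLimit hk (by rintro (_ | _); exacts [hf.1, hf.2])

instance : (isLinear K C).IsClosedUnderCokernels where
  cokernels_le := by
    rintro _ ⟨f, k, hk, hf⟩
    exact isLinear_of_isColimit hk (by rintro (_ | _); exacts [hf.1, hf.2])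

instance : (isLinear K C).ContainsZero where
  exists_zero := ⟨0, isZero_zero _, by
    have h (X : C) : IsZero ((0 : C ⥤ ModuleCat.{v} K).obj X) :=
      ((evaluation C (ModuleCat.{v} K)).obj X).map_isZero (isZero_zero _)
    exact ⟨⟨(h _).eq_of_src _ _⟩, ⟨fun _ _ => (h _).eq_of_src _ _⟩⟩⟩

instance : Abelian (Mod K C) := inferInstance

instance : HasFiniteBiproducts (Mod K C) := Abelian.hasFiniteBiproducts

instance : HasExt.{max u (v + 1)} (Mod K C) := HasExt.standard _

variable (K) in
/-- The representable module `C(X, -)`. -/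
def representable (X : C) : Mod K C :=
  ⟨(linearCoyoneda K C).obj (op X), inferInstance, ⟨fun f r => by
    ext g
    exact Linear.comp_smul _ _ _ g r f⟩⟩

/-- A module is finitely generated if it is an epimorphic image of a finite direct sum of
representable modules. -/
def IsFinGen (F : Mod K C) : Prop :=
  ∃ (n : ℕ) (X : Fin n → C) (p : (⨁ fun i => representable K (X i)) ⟶ F), Epi p

/-- A module `F` lies in `mod C` (is finitely presented) if there is an exact sequence
`P₁ ⟶ P₀ ⟶ F ⟶ 0` with `P₁` and `P₀` finitely generated projective. -/
def IsFinPres (F : Mod K C) : Prop :=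
  ∃ (P₁ P₀ : Mod K C) (d : P₁ ⟶ P₀) (p : P₀ ⟶ F) (w : d ≫ p = 0),
    Projective P₁ ∧ IsFinGen P₁ ∧ Projective P₀ ∧ IsFinGen P₀ ∧
      (ShortComplex.mk d p w).Exact ∧ Epi p

/-- A module lies in `(C, mod K)` if all its values are finite-dimensional. -/
def IsPointwiseFinite (F : Mod K C) : Prop :=
  ∀ X : C, Module.Finite K (F.obj.obj X)

/-- The right perpendicular category of a module `S`: the modules `Y` in `(C, mod K)` with
`Hom(S, Y) = 0` and `Ext¹(S, Y) = 0`. -/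
def rightPerp (S : Mod K C) : ObjectProperty (Mod K C) := fun Y =>
  IsPointwiseFinite Y ∧ (∀ f : S ⟶ Y, f = 0) ∧ ∀ e : Abelian.Ext S Y 1, e = 0

/-! ### The radical of a `K`-category and the top of a representable module -/

/-- `rad_C(X, Y)`: the morphisms `h : X ⟶ Y` such that `1_X - g h` is invertible for every
`g : Y ⟶ X`. -/
def radical (X Y : C) : Submodule K (X ⟶ Y) where
  carrier := {h | ∀ g : Y ⟶ X, IsIso (𝟙 X - h ≫ g)}
  zero_mem' g := by simpa using (inferInstance : IsIso (𝟙 X))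
  add_mem' {a b} ha hb g := by
    have h₁ := ha g
    have h₂ := hb (g ≫ inv (𝟙 X - a ≫ g))
    have e : 𝟙 X - (a + b) ≫ g =
        (𝟙 X - b ≫ g ≫ inv (𝟙 X - a ≫ g)) ≫ (𝟙 X - a ≫ g) := by
      rw [Preadditive.sub_comp]
      simp only [Category.id_comp, Category.assoc, IsIso.inv_hom_id, Category.comp_id,
        Preadditive.add_comp]
      abel
    rw [e]
    infer_instance
  smul_mem' r h hh g := by
    have := hh (r • g)
    rwa [Linear.comp_smul, ← Linear.smul_comp] at this

lemma radical_comp {X Y Z : C} {h : X ⟶ Y} (hh : h ∈ radical (K := K) X Y) (k : Y ⟶ Z) :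
    h ≫ k ∈ radical (K := K) X Z := fun g => by
  rw [Category.assoc]
  exact hh (k ≫ g)

variable (K) in
/-- The module `P / rad P`, where `P = C(X, -)` and `rad P = rad_C(X, -)`. -/
def radQuotient (X : C) : Mod K C :=
  ⟨{ obj := fun Y => ModuleCat.of K ((X ⟶ Y) ⧸ radical (K := K) X Y)
     map := fun {Y Z} k => ModuleCat.ofHom
      ((radical (K := K) X Y).mapQ (radical (K := K) X Z) (Linear.rightComp K X k)
        fun _ hh => radical_comp hh k)
     map_id := fun Y => by
      ext x
      exact congrArg Submodule.Quotient.mk (Category.comp_id x)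
     map_comp := fun f g => by
      ext x
      exact congrArg Submodule.Quotient.mk (Category.assoc x f g).symm },
    ⟨fun {Y Z f g} => by
      ext x
      exact congrArg Submodule.Quotient.mk (Preadditive.comp_add _ _ _ x f g)⟩,
    ⟨fun {Y Z} f r => by
      ext x
      exact congrArg Submodule.Quotient.mk (Linear.comp_smul _ _ _ x r f)⟩⟩

end Modules

/-! ### Restriction along a `K`-linear functor -/

section Restrict

universe u₁ u₂

variable (K : Type v) [Field K] {C : Type u₁} [Category.{v} C] [Preadditive C] [Linear K C]
  {D : Type u₂} [Category.{v} D] [Preadditive D] [Linear K D]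
  (j : C ⥤ D) [j.Additive] [j.Linear K]

/-- Restriction of modules along a `K`-linear functor: `F ↦ F ∘ j`. -/
def restrict : Mod K D ⥤ Mod K C :=
  (isLinear K C).lift
    ((isLinear K D).ι ⋙ (Functor.whiskeringLeft C D (ModuleCat.{v} K)).obj j)
    fun F => ⟨inferInstanceAs (j ⋙ F.obj).Additive, inferInstanceAs ((j ⋙ F.obj).Linear K)⟩

instance : (restrict K j).Additive where
  map_add := rfl

instance : (restrict K j).Linear K where
  map_smul _ _ := rfl

instance : PreservesFiniteLimits (restrict K j) where
  preservesFiniteLimits J _ _ := by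
    have (F G : Mod K D) (f : F ⟶ G) : PreservesLimit (parallelPair f 0) (isLinear K D).ι :=
      (isLinear K D).preservesKernels_ι f
    have : PreservesFiniteLimits (isLinear K D).ι :=
      (isLinear K D).ι.preservesFiniteLimits_of_preservesKernels
    have : PreservesLimitsOfShape J (restrict K j ⋙ (isLinear K C).ι) :=
      inferInstanceAs (PreservesLimitsOfShape J
        ((isLinear K D).ι ⋙ (Functor.whiskeringLeft C D (ModuleCat.{v} K)).obj j))
    exact preservesLimitsOfShape_of_reflects_of_preserves _ (isLinear K C).ι

instance : PreservesFiniteColimits (restrict K j) where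
  preservesFiniteColimits J _ _ := by
    have (F G : Mod K D) (f : F ⟶ G) : PreservesColimit (parallelPair f 0) (isLinear K D).ι :=
      (isLinear K D).preservesCokernels_ι f
    have : PreservesFiniteColimits (isLinear K D).ι :=
      (isLinear K D).ι.preservesFiniteColimits_of_preservesCokernels
    have : PreservesColimitsOfShape J (restrict K j ⋙ (isLinear K C).ι) :=
      inferInstanceAs (PreservesColimitsOfShape J
        ((isLinear K D).ι ⋙ (Functor.whiskeringLeft C D (ModuleCat.{v} K)).obj j))
    exact preservesColimitsOfShape_of_reflects_of_preserves _ (isLinear K C).ι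

end Restrict

/-! ### Triangular matrix categories -/

section TriMat

universe u₁ u₂

variable {K : Type v} [Field K] {T : Type u₁} [Category.{v} T] [Preadditive T] [Linear K T]
  {U : Type u₂} [Category.{v} U] [Preadditive U] [Linear K U]

/-- `M` is `K`-bilinear, that is, it is a `K`-linear functor `U ⊗ Tᵒᵖ ⥤ Mod K`. -/
class IsBimodule (M : Tᵒᵖ ⥤ U ⥤ ModuleCat.{v} K) : Prop where
  additive (t : Tᵒᵖ) : (M.obj t).Additive
  linear (t : Tᵒᵖ) : (M.obj t).Linear K
  map_add {t t' : T} (f g : t ⟶ t') : M.map (f + g).op = M.map f.op + M.map g.op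
  map_smul {t t' : T} (r : K) (f : t ⟶ t') : M.map (r • f).op = r • M.map f.op

/-- The objects of the triangular matrix category `Λ = [T 0; M U]` are the matrices
`[t 0; M u]` with `t` in `T` and `u` in `U`. -/
structure TriMat (M : Tᵒᵖ ⥤ U ⥤ ModuleCat.{v} K) where
  /-- the upper left entry -/
  t : T
  /-- the lower right entry -/
  u : U

namespace TriMat

variable {M : Tᵒᵖ ⥤ U ⥤ ModuleCat.{v} K}

/-- A morphism from `[t 0; M u]` to `[t' 0; M u']` is a matrix `[f 0; m g]`, with `f : t ⟶ t'`,
`m ∈ M(u', t)` and `g : u ⟶ u'`; it is recorded as the triple `(f, m, g)`. The composite of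
`[f₁ 0; m₁ g₁]` followed by `[f₂ 0; m₂ g₂]` is `[f₂ f₁ 0; m₂ • f₁ + g₂ • m₁ g₂ g₁]`. -/
instance : Category.{v} (TriMat M) where
  Hom X Y := (X.t ⟶ Y.t) × ((M.obj (op X.t)).obj Y.u) × (X.u ⟶ Y.u)
  id X := (𝟙 X.t, 0, 𝟙 X.u)
  comp {X _ Z} a b := (a.1 ≫ b.1,
    (M.map a.1.op).app Z.u b.2.1 + (M.obj (op X.t)).map b.2.2 a.2.1, a.2.2 ≫ b.2.2)
  id_comp a := by simp
  comp_id a := by simp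
  assoc a b c := by simp [add_assoc]

instance (X Y : TriMat M) : AddCommGroup (X ⟶ Y) :=
  inferInstanceAs (AddCommGroup ((X.t ⟶ Y.t) × ((M.obj (op X.t)).obj Y.u) × (X.u ⟶ Y.u)))

instance (X Y : TriMat M) : Module K (X ⟶ Y) :=
  inferInstanceAs (Module K ((X.t ⟶ Y.t) × ((M.obj (op X.t)).obj Y.u) × (X.u ⟶ Y.u)))

variable [IsBimodule M]

instance : Preadditive (TriMat M) where
  add_comp X Y Z a b c := by
    refine Prod.ext (Preadditive.add_comp _ _ _ _ _ _)
      (Prod.ext ?_ (Preadditive.add_comp _ _ _ _ _ _))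
    change (M.map (a.1 + b.1).op).app Z.u c.2.1 + (M.obj (op X.t)).map c.2.2 (a.2.1 + b.2.1) =
      ((M.map a.1.op).app Z.u c.2.1 + (M.obj (op X.t)).map c.2.2 a.2.1) +
      ((M.map b.1.op).app Z.u c.2.1 + (M.obj (op X.t)).map c.2.2 b.2.1)
    rw [IsBimodule.map_add, map_add]
    simp only [NatTrans.app_add, ModuleCat.hom_add, LinearMap.add_apply]
    abel
  comp_add X Y Z a b c := by
    refine Prod.ext (Preadditive.comp_add _ _ _ _ _ _)
      (Prod.ext ?_ (Preadditive.comp_add _ _ _ _ _ _))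
    change (M.map a.1.op).app Z.u (b.2.1 + c.2.1) + (M.obj (op X.t)).map (b.2.2 + c.2.2) a.2.1 =
      ((M.map a.1.op).app Z.u b.2.1 + (M.obj (op X.t)).map b.2.2 a.2.1) +
      ((M.map a.1.op).app Z.u c.2.1 + (M.obj (op X.t)).map c.2.2 a.2.1)
    have := IsBimodule.additive (M := M) (op X.t)
    rw [Functor.map_add, map_add]
    simp only [ModuleCat.hom_add, LinearMap.add_apply]
    abel

instance : Linear K (TriMat M) where
  smul_comp X Y Z r a b := by
    refine Prod.ext (Linear.smul_comp _ _ _ _ _ _)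
      (Prod.ext ?_ (Linear.smul_comp _ _ _ _ _ _))
    change (M.map (r • a.1).op).app Z.u b.2.1 + (M.obj (op X.t)).map b.2.2 (r • a.2.1) =
      r • ((M.map a.1.op).app Z.u b.2.1 + (M.obj (op X.t)).map b.2.2 a.2.1)
    rw [IsBimodule.map_smul, map_smul, smul_add]
    rfl
  comp_smul X Y Z a r b := by
    refine Prod.ext (Linear.comp_smul _ _ _ _ _ _)
      (Prod.ext ?_ (Linear.comp_smul _ _ _ _ _ _))
    change (M.map a.1.op).app Z.u (r • b.2.1) + (M.obj (op X.t)).map (r • b.2.2) a.2.1 =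
      r • ((M.map a.1.op).app Z.u b.2.1 + (M.obj (op X.t)).map b.2.2 a.2.1)
    have := IsBimodule.linear (M := M) (op X.t)
    rw [Functor.map_smul, map_smul, smul_add]
    rfl

variable (M) in
/-- The inclusion `U ⥤ Λ`, `u ↦ [0 0; M u]`. -/
def inclU [HasZeroObject T] : U ⥤ TriMat M where
  obj u := ⟨0, u⟩
  map g := (0, 0, g)
  map_id u := Prod.ext ((isZero_zero T).eq_of_src _ _) rfl
  map_comp f g := Prod.ext ((isZero_zero T).eq_of_src _ _) (Prod.ext (by
    change 0 = (M.map _).app _ 0 + (M.obj _).map g 0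
    simp) rfl)

instance [HasZeroObject T] : (inclU M).Additive where
  map_add := Prod.ext (add_zero _).symm (Prod.ext (add_zero _).symm rfl)

instance [HasZeroObject T] : (inclU M).Linear K where
  map_smul {_ u'} _ r := Prod.ext (smul_zero (A := ((0 : T) ⟶ (0 : T))) r).symm
    (Prod.ext (smul_zero (A := (M.obj (op (0 : T))).obj u') r).symm rfl)

end TriMat

end TriMat

/-! ### Quotients of `K`-categories by ideals, and path categories -/

section Ideals

variable (K : Type v) [Field K] {A : Type u} [Category.{v} A] [Preadditive A] [Linear K A]

/-- The two-sided ideal of the `K`-category `A` generated by the morphisms in `ρ`. -/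
def idealSpan (ρ : ∀ a b : A, Set (a ⟶ b)) (a b : A) : Submodule K (a ⟶ b) :=
  Submodule.span K {x | ∃ (c d : A) (p : a ⟶ c) (r : c ⟶ d) (q : d ⟶ b),
    r ∈ ρ c d ∧ x = p ≫ r ≫ q}

variable {K} in
lemma idealSpan_comp {ρ : ∀ a b : A, Set (a ⟶ b)} {a b c : A} {f : a ⟶ b}
    (hf : f ∈ idealSpan K ρ a b) (g : b ⟶ c) : f ≫ g ∈ idealSpan K ρ a c := by
  refine (Submodule.span_le (p := (idealSpan K ρ a c).comap (Linear.rightComp K a g))).2 ?_ hf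
  rintro _ ⟨c, d, p, r, q, hr, rfl⟩
  exact Submodule.subset_span ⟨c, d, p, r, q ≫ g, hr, by simp⟩

variable {K} in
lemma comp_idealSpan {ρ : ∀ a b : A, Set (a ⟶ b)} {a b c : A} (g : a ⟶ b) {f : b ⟶ c}
    (hf : f ∈ idealSpan K ρ b c) : g ≫ f ∈ idealSpan K ρ a c := by
  refine (Submodule.span_le (p := (idealSpan K ρ a c).comap (Linear.leftComp K c g))).2 ?_ hf
  rintro _ ⟨c, d, p, r, q, hr, rfl⟩
  exact Submodule.subset_span ⟨c, d, g ≫ p, r, q, hr, by simp⟩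

/-- Two morphisms are related if their difference lies in the ideal generated by `ρ`. -/
def idealRel (ρ : ∀ a b : A, Set (a ⟶ b)) : HomRel A :=
  fun a b f g => f - g ∈ idealSpan K ρ a b

instance (ρ : ∀ a b : A, Set (a ⟶ b)) : Congruence (idealRel K ρ) where
  equivalence :=
    { refl := fun f => by
        change f - f ∈ _
        simp
      symm := fun {f g} h => by
        have := neg_mem (show f - g ∈ idealSpan K ρ _ _ from h)
        rwa [neg_sub] at this
      trans := fun {f g h} h₁ h₂ => by
        have := add_mem (show f - g ∈ idealSpan K ρ _ _ from h₁) h₂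
        rwa [sub_add_sub_cancel] at this }
  comp_left f g g' h := by
    have := comp_idealSpan f h
    rwa [Preadditive.comp_sub] at this
  comp_right g h := by
    have := idealSpan_comp h g
    rwa [Preadditive.sub_comp] at this

/-- The quotient of the `K`-category `A` by the ideal generated by `ρ`. -/
abbrev IdealQuotient (ρ : ∀ a b : A, Set (a ⟶ b)) := Quotient (idealRel K ρ)

instance (ρ : ∀ a b : A, Set (a ⟶ b)) : Preadditive (IdealQuotient K ρ) :=
  Quotient.preadditive _ fun _ _ f₁ f₂ g₁ g₂ h₁ h₂ => by
    have := add_mem (show f₁ - f₂ ∈ idealSpan K ρ _ _ from h₁) h₂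
    rwa [sub_add_sub_comm] at this

instance (ρ : ∀ a b : A, Set (a ⟶ b)) : (Quotient.functor (idealRel K ρ)).Additive where
  map_add := rfl

instance (ρ : ∀ a b : A, Set (a ⟶ b)) : Linear K (IdealQuotient K ρ) :=
  Quotient.linear K _ fun r _ _ f₁ f₂ h => by
    have := Submodule.smul_mem _ r (show f₁ - f₂ ∈ idealSpan K ρ _ _ from h)
    rwa [smul_sub] at this

/-- The additive hull of a `K`-category (finite direct sums of objects, matrices of morphisms)
is a `K`-category. -/
instance : Linear K (Mat_ A) where
  homModule X Y := inferInstanceAs (Module K (∀ (i : X.ι) (j : Y.ι), X.X i ⟶ Y.X j))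
  smul_comp X Y Z r f g := by
    ext i k
    change ∑ j, (r • f i j) ≫ g j k = r • ∑ j, f i j ≫ g j k
    simp [Finset.smul_sum]
  comp_smul X Y Z f r g := by
    ext i k
    change ∑ j, f i j ≫ (r • g j k) = r • ∑ j, f i j ≫ g j k
    simp [Finset.smul_sum]

end Ideals

section Add

variable {C : Type u} [Category.{v} C] [Preadditive C] [HasFiniteBiproducts C]

/-- `add P`: the direct summands of finite direct sums of objects in `P`. -/
def addClosure (P : ObjectProperty C) : ObjectProperty C := fun X =>
  ∃ (n : ℕ) (Z : Fin n → C), (∀ i, P (Z i)) ∧ Nonempty (Retract X (⨁ Z))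

instance (P : ObjectProperty C) : (addClosure P).ContainsZero where
  exists_zero := by
    refine ⟨⨁ (Fin.elim0 : Fin 0 → C), ?_, 0, Fin.elim0, fun i => i.elim0, ⟨Retract.refl _⟩⟩
    rw [IsZero.iff_id_eq_zero]
    exact biproduct.hom_ext _ _ fun i => i.elim0

end Add

section OnePoint

/-- A quiver is strongly locally finite if every vertex is the source of finitely many arrows and
the target of finitely many arrows, and there are finitely many paths between any two vertices. -/
structure IsStronglyLocallyFinite (Q : Type u) [Quiver.{u} Q] : Prop where
  finite_out (x : Q) : Finite (Σ y : Q, x ⟶ y)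
  finite_in (x : Q) : Finite (Σ y : Q, y ⟶ x)
  finite_paths (x y : Q) : Finite (Quiver.Path x y)

/-- A set of relations on `Q`: a set of finite linear combinations of parallel paths of
length at least `2`. The set `ρ a b` consists of the relations from `a` to `b`. -/
def IsRelationSet {K : Type u} [Field K] {Q : Type u} [Quiver.{u} Q]
    (ρ : ∀ a b : Q, Set (Quiver.Path a b →₀ K)) : Prop :=
  ∀ (a b : Q), ∀ r ∈ ρ a b, ∀ p ∈ r.support, 2 ≤ p.length

variable {K : Type u} [Field K] {Q : Type u} [Quiver.{u} Q]
  (ρ : ∀ a b : Q, Set (Quiver.Path a b →₀ K)) (star : Q)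

/-- The relations as morphisms of the `K`-linearization of the category of paths in `Q`. -/
def pathRel : ∀ a b : Free K (Paths Q), Set (a ⟶ b) := ρ

/-- The category with the vertices of `Q` as objects and with the space of morphisms from `a` to
`b` equal to the space of linear combinations of paths modulo the ideal `I = ⟨ρ⟩`. -/
abbrev VertexCat :=
  IdealQuotient K (pathRel ρ)

/-- The path category `C = KQ/I` with `I = ⟨ρ⟩`: its objects are the finite direct sums of
vertices, its morphisms the matrices with entries in `KQ/I`. -/
abbrev PathCat := Mat_ (VertexCat ρ)

/-- A vertex as an object of the path category. -/
def vertex (q : Q) : PathCat ρ :=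
  (Mat_.embedding (VertexCat ρ)).obj ((Quotient.functor _).obj (Free.of K (C := Paths Q) q))

/-- `T = add {*}`. -/
abbrev CatT := (addClosure fun X : PathCat ρ => X = vertex ρ star).FullSubcategory

/-- `U = add (Q₀ ∖ {*})`. -/
abbrev CatU := (addClosure fun X : PathCat ρ => ∃ q : Q, q ≠ star ∧ X = vertex ρ q).FullSubcategory

/-- The bimodule `M(u, t) = C(t, u)`. -/
def bimod : (CatT ρ star)ᵒᵖ ⥤ CatU ρ star ⥤ ModuleCat.{u} K :=
  (ObjectProperty.ι _).op ⋙ linearCoyoneda K (PathCat ρ) ⋙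
    (Functor.whiskeringLeft _ _ _).obj (ObjectProperty.ι _)

instance : IsBimodule (bimod ρ star) where
  additive t := ⟨fun {u u' f g} => by
    ext h
    exact Preadditive.comp_add _ _ _ h f.hom g.hom⟩
  linear t := ⟨fun {u u'} f r => by
    ext h
    exact Linear.comp_smul _ _ _ h r f.hom⟩
  map_add f g := by
    ext u h
    exact Preadditive.add_comp _ _ _ f.hom g.hom h
  map_smul r f := by
    ext u h
    exact Linear.smul_comp _ _ _ r f.hom h

/-- The one-point extension `Λ = [T 0; M U]`. -/
abbrev Lam := TriMat (bimod ρ star)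

/-- The object `[* 0; M 0]` of `Λ`. -/
def starObj : Lam ρ star :=
  ⟨⟨vertex ρ star, 1, fun _ => vertex ρ star, fun _ => rfl,
    ⟨⟨biproduct.ι (fun _ : Fin 1 => vertex ρ star) 0,
      biproduct.π (fun _ : Fin 1 => vertex ρ star) 0, by simp⟩⟩⟩, 0⟩

/-- The `Λ`-module `S = P / rad P`, where `P` is represented by `[* 0; M 0]`. -/
def simpleS : Mod K (Lam ρ star) := radQuotient K (starObj ρ star)

/-- The restriction functor `R : Mod Λ ⥤ Mod U`, `(R F)(u) = F([0 0; M u])`. -/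
abbrev restr : Mod K (Lam ρ star) ⥤ Mod K (CatU ρ star) :=
  restrict K (TriMat.inclU (bimod ρ star))

end OnePoint

end

end OnePointExt

/-! Write `R` for restriction to `U`. It has an exact left adjoint `L`, extension by zero, which is
itself restriction along the projection `Λ ⥤ U`. The counit `L R X ⟶ X` is a monomorphism whose
cokernel `Z` vanishes on `U`. In the long exact sequence `Ext^j(Z,Y) → Ext^j(X,Y) → Ext^j(LRX,Y) →
Ext^(j+1)(Z,Y)` the third term corresponds to `Ext^j(RX,RY)` by the exact adjunction. So (a) and (b)
follow once `Ext^j(Z,Y) = 0` for `j ≥ 2`, and (c) once `Ext^1(Z,Y) = 0`.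

To control `Z`, let `P` be the module represented by `[* 0; M 0]` and `V` the value of `Z` at that
object. As `*` is a source, its endomorphisms are scalars, and there is a short exact sequence `0 →
LR(P ⊗ V) → P ⊗ V → Z → 0` (`copower_shortExact`). Since no relation starts at `*`, a morphism from
`*` into `U` expands uniquely along the arrows leaving `*`; hence `RP` is projective
(`projective_restr_starObj`) and `Z` has projective dimension at most one.

For (c), `rad P` is `LRP`, so `Ext^1(S,Y) = 0` says that every map `LRP ⟶ Y` extends to `P`. Over a
field the extensions can be chosen linearly, hence also for `P ⊗ V`, and `Ext^1(Z,Y) = 0` follows.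
-/

section ExtGeneral

universe w w' u₁ u₂ v₁ v₂

/-! ### Ext groups under exact adjoint functors -/

namespace CochainComplex

variable {A : Type u₁} [Category.{v₁} A] [Abelian A]

/-- A quasi-isomorphism to a complex concentrated in degree `0` is an epimorphism in degree `0`. -/
lemma epi_f_zero_of_quasiIso {X : A} {K : CochainComplex A ℤ}
    (s : K ⟶ (CochainComplex.singleFunctor A 0).obj X) [QuasiIso s] : Epi (s.f 0) := by
  let SX := (CochainComplex.singleFunctor A 0).obj X
  have h₁ : IsIso (SX.iCycles 0) := SX.isIso_iCycles 0 1 (by simp)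
    ((SX.isZero_of_isStrictlyLE 0 1).eq_of_tgt _ _)
  have h₂ : IsIso (SX.homologyπ 0) := SX.isIso_homologyπ (-1) 0 (by simp)
    ((SX.isZero_of_isStrictlyGE 0 (-1)).eq_of_src _ _)
  have h₃ : Epi (HomologicalComplex.cyclesMap s 0) := by
    have : HomologicalComplex.cyclesMap s 0 = K.homologyπ 0 ≫
        HomologicalComplex.homologyMap s 0 ≫ inv (SX.homologyπ 0) := by
      rw [HomologicalComplex.homologyπ_naturality_assoc]
      simp [SX]
    rw [this]
    infer_instance
  have h₄ : Epi (K.iCycles 0 ≫ s.f 0) := by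
    rw [← HomologicalComplex.cyclesMap_i]
    exact epi_comp _ (SX.iCycles 0)
  exact epi_of_epi (K.iCycles 0) _

end CochainComplex

namespace CategoryTheory.Abelian.Ext

variable {A : Type u₁} [Category.{v₁} A] [Abelian A] [HasExt.{w} A]
  {B : Type u₂} [Category.{v₂} B] [Abelian B] [HasExt.{w'} B]

open _root_.DerivedCategory in
attribute [local instance] HasDerivedCategory.standard in
/-- Every extension of positive degree is killed by an epimorphism. -/
lemma exists_epi_mk₀_comp_eq_zero {X Y : A} {n : ℕ} (e : Ext X Y (n + 1)) :
    ∃ (X' : A) (p : X' ⟶ X) (_ : Epi p), (mk₀ p).comp e (zero_add _) = 0 := by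
  let SX := (CochainComplex.singleFunctor A 0).obj X
  let SY := (CochainComplex.singleFunctor A 0).obj Y
  let T := SY⟦((n + 1 : ℕ) : ℤ)⟧
  have hT : T.IsStrictlyGE (-((n + 1 : ℕ) : ℤ)) :=
    CochainComplex.isStrictlyGE_shift _ 0 _ _ (by lia)
  have hT' : T.IsStrictlyLE (-((n + 1 : ℕ) : ℤ)) :=
    CochainComplex.isStrictlyLE_shift _ 0 _ _ (by lia)
  let c : Q.obj T ≅ (Q.obj SY)⟦((n + 1 : ℕ) : ℤ)⟧ := (Q.commShiftIso ((n + 1 : ℕ) : ℤ)).app SY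
  let f : Q.obj SX ⟶ Q.obj T := e.hom ≫ c.inv
  -- A right fraction with `K` in degrees `≤ 0`. The target `T` sits in degree `-(n+1) < 0`, so the
  -- numerator `g` vanishes in degree `0`, and the epimorphism sought is `s` in degree `0`.
  obtain ⟨K, hK, s, hs, g, hf⟩ := right_fac_of_isStrictlyLE f 0
  have hs' : QuasiIso s := (isIso_Q_map_iff_quasiIso (C := A) s).1 hs
  let r : SX.X 0 ≅ X := HomologicalComplex.singleObjXSelf (ComplexShape.up ℤ) 0 X
  refine ⟨K.X 0, s.f 0 ≫ r.hom, ?_, ?_⟩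
  · have := CochainComplex.epi_f_zero_of_quasiIso s
    exact epi_comp _ _
  -- All of `K.X 0` consists of cycles because `K.X 1 = 0`, so it maps to `K` as a complex.
  · let σ : (CochainComplex.singleFunctor A 0).obj (K.X 0) ⟶ K :=
      HomologicalComplex.mkHomFromSingle (𝟙 _)
        (fun i (hi : 0 + 1 = i) ↦ (K.isZero_of_isStrictlyLE 0 i).eq_of_tgt _ _)
    have h₁ : (CochainComplex.singleFunctor A 0).map (s.f 0 ≫ r.hom) = σ ≫ s := by
      apply HomologicalComplex.from_single_hom_ext
      have h₀ : σ.f 0 = (HomologicalComplex.singleObjXSelf (ComplexShape.up ℤ) 0 (K.X 0)).hom :=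
        (HomologicalComplex.mkHomFromSingle_f _ _).trans (Category.comp_id _)
      refine (HomologicalComplex.single_map_f_self _ _ _).trans ?_
      rw [HomologicalComplex.comp_f, h₀]
      simp only [Category.assoc]
      exact (congrArg (fun t => _ ≫ s.f 0 ≫ t) r.hom_inv_id).trans
        (congrArg (_ ≫ ·) (Category.comp_id _))
    have h₂ : σ ≫ g = 0 := by
      apply HomologicalComplex.from_single_hom_ext
      exact (T.isZero_of_isStrictlyLE (-((n + 1 : ℕ) : ℤ)) 0).eq_of_tgt _ _
    have h₃ : (singleFunctor A 0).map (s.f 0 ≫ r.hom) ≫ f = 0 := by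
      change Q.map ((CochainComplex.singleFunctor A 0).map (s.f 0 ≫ r.hom)) ≫ f = 0
      rw [h₁, hf, Functor.map_comp, Category.assoc, IsIso.hom_inv_id_assoc, ← Functor.map_comp, h₂,
        Functor.map_zero]
    have h₄ : (singleFunctor A 0).map (s.f 0 ≫ r.hom) ≫ e.hom = 0 := by
      have h : (singleFunctor A 0).map (s.f 0 ≫ r.hom) ≫ f ≫ c.hom = 0 :=
        (Category.assoc _ _ _).symm.trans ((congrArg (· ≫ c.hom) h₃).trans Limits.zero_comp)
      exact (congrArg (fun t => (singleFunctor A 0).map (s.f 0 ≫ r.hom) ≫ t)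
        (((Category.assoc _ _ _).trans (congrArg (e.hom ≫ ·) c.inv_hom_id)).trans
          (Category.comp_id _))).symm.trans h
    ext
    rw [comp_hom, mk₀_hom, ShiftedHom.mk₀_comp, h₄, zero_hom]

/-- Every extension of degree `n + 1` factors through the class of a short exact sequence. -/
lemma exists_eq_extClass_comp {X Y : A} {n : ℕ} (e : Ext X Y (n + 1)) :
    ∃ (Z X' : A) (i : Z ⟶ X') (p : X' ⟶ X) (w : i ≫ p = 0)
      (h : (ShortComplex.mk i p w).ShortExact) (e' : Ext Z Y n),
      e = h.extClass.comp e' (add_comm 1 n) := by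
  obtain ⟨X', p, hp, he⟩ := exists_epi_mk₀_comp_eq_zero e
  have h : (ShortComplex.mk (kernel.ι p) p (kernel.condition p)).ShortExact :=
    { exact := ShortComplex.exact_of_f_is_kernel _ (kernelIsKernel p) }
  obtain ⟨e', he'⟩ := contravariant_sequence_exact₃ h Y e he (add_comm 1 n)
  exact ⟨_, _, _, _, _, h, e', he'.symm⟩

variable (L : A ⥤ B) [L.Additive] [PreservesFiniteLimits L] [PreservesFiniteColimits L]
  (R : B ⥤ A) [R.Additive] [PreservesFiniteLimits R] [PreservesFiniteColimits R]

/-- A natural transformation from the identity to a composite of exact functors is natural with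
respect to extensions. -/
lemma comp_mk₀_unit (η : 𝟭 A ⟶ L ⋙ R) {X Y : A} {n : ℕ} (e : Ext X Y n) :
    e.comp (mk₀ (η.app Y)) (add_zero n) =
      (mk₀ (η.app X)).comp ((e.mapExactFunctor L).mapExactFunctor R) (zero_add n) := by
  induction n generalizing X with
  | zero =>
    obtain ⟨f, rfl⟩ := (mk₀_bijective X Y).2 e
    simp only [mapExactFunctor_mk₀, mk₀_comp_mk₀]
    exact congrArg mk₀ (η.naturality f)
  | succ n ih =>
    obtain ⟨Z, X', i, p, w, h, e', rfl⟩ := exists_eq_extClass_comp e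
    -- `η` is a morphism of short exact sequences, so it commutes with the degree one factor; the
    -- induction hypothesis moves it past the remaining factor.
    let φ : ShortComplex.mk i p w ⟶ ((ShortComplex.mk i p w).map L).map R :=
      { τ₁ := η.app _
        τ₂ := η.app _
        τ₃ := η.app _
        comm₁₂ := (η.naturality i).symm
        comm₂₃ := (η.naturality p).symm }
    have key := ShortComplex.ShortExact.extClass_naturality h
      ((h.map_of_exact L).map_of_exact R) φ
    have hc : h.extClass.comp (mk₀ (η.app Z)) (add_zero 1) = (mk₀ (η.app X)).comp
        ((h.extClass.mapExactFunctor L).mapExactFunctor R) (zero_add 1) :=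
      key.trans (congrArg (fun t => (mk₀ (η.app X)).comp t (zero_add 1))
        ((congrArg (mapExactFunctor R) (mapExactFunctor_extClass L h)).trans
          (mapExactFunctor_extClass R (h.map_of_exact L))).symm)
    rw [comp_assoc_of_third_deg_zero, ih, mapExactFunctor_comp, mapExactFunctor_comp,
      ← comp_assoc_of_second_deg_zero, ← comp_assoc (a₁₂ := 1) (mk₀ (η.app X)) _ _ _ _ (by lia), hc]

/-- A natural transformation from a composite of exact functors to the identity is natural with
respect to extensions. -/
lemma mapExactFunctor_comp_mk₀_counit (ε : R ⋙ L ⟶ 𝟭 B) {X Y : B} {n : ℕ} (e : Ext X Y n) :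
    ((e.mapExactFunctor R).mapExactFunctor L).comp (mk₀ (ε.app Y)) (add_zero n) =
      (mk₀ (ε.app X)).comp e (zero_add n) := by
  induction n generalizing X with
  | zero =>
    obtain ⟨f, rfl⟩ := (mk₀_bijective X Y).2 e
    simp only [mapExactFunctor_mk₀, mk₀_comp_mk₀]
    exact congrArg mk₀ (ε.naturality f)
  | succ n ih =>
    obtain ⟨Z, X', i, p, w, h, e', rfl⟩ := exists_eq_extClass_comp e
    let φ : ((ShortComplex.mk i p w).map R).map L ⟶ ShortComplex.mk i p w :=
      { τ₁ := ε.app _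
        τ₂ := ε.app _
        τ₃ := ε.app _
        comm₁₂ := (ε.naturality i).symm
        comm₂₃ := (ε.naturality p).symm }
    have key := ShortComplex.ShortExact.extClass_naturality
      ((h.map_of_exact R).map_of_exact L) h φ
    have hc : ((h.extClass.mapExactFunctor R).mapExactFunctor L).comp (mk₀ (ε.app Z))
        (add_zero 1) = (mk₀ (ε.app X)).comp h.extClass (zero_add 1) :=
      (congrArg (fun t => t.comp (mk₀ (ε.app Z)) (add_zero 1))
        ((congrArg (mapExactFunctor L) (mapExactFunctor_extClass R h)).trans
          (mapExactFunctor_extClass L (h.map_of_exact R)))).trans key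
    rw [mapExactFunctor_comp, mapExactFunctor_comp, comp_assoc_of_third_deg_zero, ih,
      ← comp_assoc_of_second_deg_zero, ← comp_assoc (a₁₂ := 1) (mk₀ (ε.app X)) _ _ _ _ (by lia), hc]

variable {L R}

/-- The adjunct of `e`, namely `L e` followed by the counit of `Y`, is a class in `Ext^n(LRX, Y)`.
Its obstruction to coming from `X` along the counit lies in `Ext^(1+n)(Z, Y) = 0`, and the triangle
identities show that a lift is sent by `R` to `e`. -/
lemma mapExactFunctor_surjective_of_adjunction (adj : L ⊣ R) {X Y : B}
    {Z : B} {p : X ⟶ Z} {w : adj.counit.app X ≫ p = 0}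
    (h : (ShortComplex.mk (adj.counit.app X) p w).ShortExact) {n : ℕ}
    (hZ : ∀ e : Ext Z Y (1 + n), e = 0) :
    Function.Surjective (R.mapExtAddHom X Y n) := by
  intro e
  obtain ⟨e', he'⟩ := contravariant_sequence_exact₁ h Y
    ((e.mapExactFunctor L).comp (mk₀ (adj.counit.app Y)) (add_zero n)) rfl (hZ _)
  refine ⟨e', ?_⟩
  -- Passing back through the adjunction: apply `R` and precompose with the unit. Naturality of the
  -- unit for extensions then exposes both triangle identities.
  replace he' := congrArg (fun t => (mk₀ (adj.unit.app (R.obj X))).comp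
    (mapExactFunctor R t) (zero_add n)) he'
  dsimp only at he'
  rw [mapExactFunctor_comp, mapExactFunctor_mk₀, mapExactFunctor_comp, mapExactFunctor_mk₀] at he'
  rw [mk₀_comp_mk₀_assoc, ← comp_assoc_of_third_deg_zero (mk₀ _) _ _ (zero_add n),
    ← comp_mk₀_unit L R adj.unit, comp_assoc_of_second_deg_zero, mk₀_comp_mk₀] at he'
  have t (W : B) : adj.unit.app (R.obj W) ≫ R.map (adj.counit.app W) = 𝟙 _ :=
    adj.right_triangle_components W
  dsimp only [Functor.comp_obj, Functor.id_obj] at he'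
  rw [t, t] at he'
  exact (mk₀_id_comp _).symm.trans (he'.trans (comp_mk₀_id _))

/-- If `R e = 0`, naturality of the counit shows that `e` dies on `LRX`, so it comes from `Ext^n(Z,
Y) = 0`. -/
lemma mapExactFunctor_injective_of_adjunction (adj : L ⊣ R) {X Y : B}
    {Z : B} {p : X ⟶ Z} {w : adj.counit.app X ≫ p = 0}
    (h : (ShortComplex.mk (adj.counit.app X) p w).ShortExact) {n : ℕ}
    (hZ : ∀ e : Ext Z Y n, e = 0) :
    Function.Injective (R.mapExtAddHom X Y n) := by
  rw [injective_iff_map_eq_zero]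
  intro e (he : e.mapExactFunctor R = 0)
  have h₁ := mapExactFunctor_comp_mk₀_counit L R adj.counit e
  rw [he, mapExactFunctor_zero, zero_comp] at h₁
  obtain ⟨e', rfl⟩ := contravariant_sequence_exact₂ h Y e h₁.symm
  rw [hZ e', comp_zero]

end CategoryTheory.Abelian.Ext

end ExtGeneral

namespace OnePointExt

noncomputable section

/-! ### Pointwise exactness, projective modules and copowers -/

section ModuleTheory

variable {K : Type v} [Field K] {C : Type u} [Category.{v} C] [Preadditive C] [Linear K C]

variable (K) in
/-- Evaluation of modules at an object. -/
def evalAt (X : C) : Mod K C ⥤ ModuleCat.{v} K :=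
  (isLinear K C).ι ⋙ (evaluation C (ModuleCat.{v} K)).obj X

instance (X : C) : (evalAt K X).Additive where
  map_add := rfl

instance : PreservesFiniteLimits (isLinear K C).ι := by
  have (F G : Mod K C) (f : F ⟶ G) : PreservesLimit (parallelPair f 0) (isLinear K C).ι :=
    (isLinear K C).preservesKernels_ι f
  exact (isLinear K C).ι.preservesFiniteLimits_of_preservesKernels

instance : PreservesFiniteColimits (isLinear K C).ι := by
  have (F G : Mod K C) (f : F ⟶ G) : PreservesColimit (parallelPair f 0) (isLinear K C).ι :=
    (isLinear K C).preservesCokernels_ι f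
  exact (isLinear K C).ι.preservesFiniteColimits_of_preservesCokernels

instance (X : C) : PreservesFiniteLimits (evalAt K X) :=
  comp_preservesFiniteLimits _ _

instance (X : C) : PreservesFiniteColimits (evalAt K X) :=
  comp_preservesFiniteColimits _ _

/-- The component at `X` of a morphism of modules, as a linear map. -/
def appAt {F G : Mod K C} (f : F ⟶ G) (X : C) : F.obj.obj X →ₗ[K] G.obj.obj X :=
  (f.hom.app X).hom

/-- The action of a morphism of `C` on a module, as a linear map. -/
def act (F : Mod K C) {X Y : C} (h : X ⟶ Y) : F.obj.obj X →ₗ[K] F.obj.obj Y :=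
  (F.obj.map h).hom

lemma act_id (F : Mod K C) {X : C} (x : F.obj.obj X) : act F (𝟙 X) x = x := by
  simp [act]

lemma act_comp (F : Mod K C) {X Y Z : C} (h : X ⟶ Y) (k : Y ⟶ Z) (x : F.obj.obj X) :
    act F (h ≫ k) x = act F k (act F h x) := by
  simp [act]

lemma act_add (F : Mod K C) {X Y : C} (h k : X ⟶ Y) (x : F.obj.obj X) :
    act F (h + k) x = act F h x + act F k x := by
  simp [act, F.obj.map_add]

lemma act_zero (F : Mod K C) {X Y : C} (x : F.obj.obj X) :
    act F (0 : X ⟶ Y) x = 0 := by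
  simp [act]

lemma act_sum (F : Mod K C) {X Y : C} {ι : Type*} (s : Finset ι) (h : ι → (X ⟶ Y))
    (x : F.obj.obj X) : act F (∑ i ∈ s, h i) x = ∑ i ∈ s, act F (h i) x := by
  classical
  induction s using Finset.induction_on with
  | empty => simp [act_zero]
  | insert a s ha ih => rw [Finset.sum_insert ha, Finset.sum_insert ha, act_add, ih]

lemma act_smul (F : Mod K C) {X Y : C} (r : K) (h : X ⟶ Y) (x : F.obj.obj X) :
    act F (r • h) x = r • act F h x := by
  simp [act, Functor.map_smul]

lemma appAt_act {F G : Mod K C} (f : F ⟶ G) {X Y : C} (h : X ⟶ Y) (x : F.obj.obj X) :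
    appAt f Y (act F h x) = act G h (appAt f X x) :=
  congrArg (fun t => t.hom x) (f.hom.naturality h)

lemma appAt_comp {F G H : Mod K C} (f : F ⟶ G) (g : G ⟶ H) (X : C) (x : F.obj.obj X) :
    appAt (f ≫ g) X x = appAt g X (appAt f X x) := rfl

lemma Mod.hom_ext {F G : Mod K C} {f g : F ⟶ G} (h : ∀ X x, appAt f X x = appAt g X x) :
    f = g := by
  apply ObjectProperty.hom_ext
  ext X x
  exact h X x

/-- A morphism of modules from compatible linear maps. -/
def Mod.homMk {F G : Mod K C} (φ : ∀ X, F.obj.obj X →ₗ[K] G.obj.obj X)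
    (h : ∀ ⦃X Y : C⦄ (k : X ⟶ Y) (x : F.obj.obj X), φ Y (act F k x) = act G k (φ X x)) :
    F ⟶ G :=
  ObjectProperty.homMk
    { app := fun X => ModuleCat.ofHom (φ X)
      naturality := fun X Y k => by
        ext x
        exact h k x }

lemma appAt_homMk {F G : Mod K C} (φ : ∀ X, F.obj.obj X →ₗ[K] G.obj.obj X)
    (h : ∀ ⦃X Y : C⦄ (k : X ⟶ Y) (x : F.obj.obj X), φ Y (act F k x) = act G k (φ X x)) (X : C) :
    appAt (Mod.homMk φ h) X = φ X := rfl

lemma Mod.isZero_of_evalAt {F : Mod K C} (h : ∀ X, IsZero ((evalAt K X).obj F)) : IsZero F := by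
  rw [IsZero.iff_id_eq_zero]
  exact Mod.hom_ext fun X x => congrArg (fun t => t.hom x) ((h X).eq_of_src
    ((evalAt K X).map (𝟙 F)) ((evalAt K X).map 0))

lemma appAt_surjective {F G : Mod K C} (f : F ⟶ G) [Epi f] (X : C) :
    Function.Surjective (appAt f X) :=
  (ModuleCat.epi_iff_surjective _).1 (inferInstanceAs (Epi ((evalAt K X).map f)))

lemma Mod.mono_of_injective {F G : Mod K C} (f : F ⟶ G)
    (h : ∀ X, Function.Injective (appAt f X)) : Mono f where
  right_cancellation a b hab := Mod.hom_ext fun X x => h X (by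
    rw [← appAt_comp, ← appAt_comp, hab])

lemma Mod.epi_of_surjective {F G : Mod K C} (f : F ⟶ G)
    (h : ∀ X, Function.Surjective (appAt f X)) : Epi f where
  left_cancellation a b hab := Mod.hom_ext fun X x => by
    obtain ⟨y, rfl⟩ := h X x
    rw [← appAt_comp, ← appAt_comp, hab]

/-- Evaluations are exact and jointly detect zero modules, so homology is computed pointwise. -/
lemma Mod.exact_of_forall (S : ShortComplex (Mod K C))
    (h : ∀ X x, appAt S.g X x = 0 → ∃ y, appAt S.f X y = x) : S.Exact := by
  rw [ShortComplex.exact_iff_isZero_homology]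
  refine Mod.isZero_of_evalAt fun X => ?_
  refine IsZero.of_iso ?_ (S.mapHomologyIso (evalAt K X)).symm
  rw [← ShortComplex.exact_iff_isZero_homology, ShortComplex.moduleCat_exact_iff]
  exact fun x hx => h X x hx

lemma Mod.shortExact_of_forall (S : ShortComplex (Mod K C))
    (h₁ : ∀ X, Function.Injective (appAt S.f X))
    (h₂ : ∀ X x, appAt S.g X x = 0 → ∃ y, appAt S.f X y = x)
    (h₃ : ∀ X, Function.Surjective (appAt S.g X)) : S.ShortExact :=
  { exact := Mod.exact_of_forall S h₂
    mono_f := Mod.mono_of_injective _ h₁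
    epi_g := Mod.epi_of_surjective _ h₃ }

/-- The morphism from a representable module given by an element. -/
def yonedaMap (F : Mod K C) (X : C) : F.obj.obj X →ₗ[K] (representable K X ⟶ F) where
  toFun x := Mod.homMk (F := representable K X)
    (fun Y =>
      { toFun := fun (h : X ⟶ Y) => act F h x
        map_add' := fun h k => act_add F h k x
        map_smul' := fun r h => act_smul F r h x })
    (fun _ _ k h => act_comp F h k x)
  map_add' x y := Mod.hom_ext fun _ h => map_add (act F h) x y
  map_smul' r x := Mod.hom_ext fun _ h => map_smul (act F h) r x

/-- A module with a finite basis is projective. -/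
lemma projective_of_basis (F : Mod K C) {ι : Type*} [Fintype ι] (q : ι → C)
    (x : ∀ i, F.obj.obj (q i))
    (hx : ∀ Y, Function.Bijective fun g : (∀ i, q i ⟶ Y) => ∑ i, act F (g i) (x i)) :
    Projective F where
  factors {E G} f e _ := by
    -- As for free modules, it is enough to lift the images of the basis elements.
    choose y hy using fun i => appAt_surjective e (q i) (appAt f (q i) (x i))
    let φ (Y : C) : (∀ i, q i ⟶ Y) ≃ₗ[K] F.obj.obj Y := LinearEquiv.ofBijective
      { toFun := fun g => ∑ i, act F (g i) (x i)
        map_add' := fun g g' => by simp [act_add, Finset.sum_add_distrib]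
        map_smul' := fun r g => by simp [act_smul, Finset.smul_sum] } (hx Y)
    let ψ (Y : C) : (∀ i, q i ⟶ Y) →ₗ[K] E.obj.obj Y :=
      { toFun := fun g => ∑ i, act E (g i) (y i)
        map_add' := fun g g' => by simp [act_add, Finset.sum_add_distrib]
        map_smul' := fun r g => by simp [act_smul, Finset.smul_sum] }
    have hφ (Y : C) (g : ∀ i, q i ⟶ Y) : φ Y g = ∑ i, act F (g i) (x i) := rfl
    have hψ (Y : C) (g : ∀ i, q i ⟶ Y) : ψ Y g = ∑ i, act E (g i) (y i) := rfl
    refine ⟨Mod.homMk (fun Y => ψ Y ∘ₗ (φ Y).symm.toLinearMap) ?_, ?_⟩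
    · intro Y Z k z
      obtain ⟨g, rfl⟩ := (φ Y).surjective z
      have : act F k (φ Y g) = φ Z (fun i => g i ≫ k) := by
        simp [hφ, act_comp]
      simp [this, hψ, act_comp]
    · refine Mod.hom_ext fun Y z => ?_
      obtain ⟨g, rfl⟩ := (φ Y).surjective z
      rw [appAt_comp, appAt_homMk, LinearMap.comp_apply, LinearEquiv.coe_coe,
        LinearEquiv.symm_apply_apply, hψ, hφ]
      simp only [map_sum, appAt_act, hy]

open scoped TensorProduct

/-- The copower of a module by a vector space. -/
def copower (G : Mod K C) (V : Type v) [AddCommGroup V] [Module K V] : Mod K C :=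
  ⟨{ obj := fun X => ModuleCat.of K (G.obj.obj X ⊗[K] V)
     map := fun k => ModuleCat.ofHom ((act G k).rTensor V)
     map_id := fun X => by
      ext1
      exact TensorProduct.ext' fun x v => congrArg (· ⊗ₜ v) (act_id G x)
     map_comp := fun h k => by
      ext1
      exact TensorProduct.ext' fun x v => congrArg (· ⊗ₜ v) (act_comp G h k x) },
    ⟨fun {X Y f g} => by
      ext1
      exact TensorProduct.ext' fun x v => (congrArg (· ⊗ₜ v) (act_add G f g x)).trans
        (TensorProduct.add_tmul _ _ _)⟩,
    ⟨fun {X Y} f r => by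
      ext1
      exact TensorProduct.ext' fun x v => (congrArg (· ⊗ₜ v) (act_smul G r f x)).trans
        (TensorProduct.smul_tmul' _ _ _).symm⟩⟩

variable {V : Type v} [AddCommGroup V] [Module K V]

lemma copower_hom_ext {G F : Mod K C} {f g : copower G V ⟶ F}
    (h : ∀ X (x : G.obj.obj X) (v : V), appAt f X (x ⊗ₜ[K] v) = appAt g X (x ⊗ₜ[K] v)) : f = g :=
  Mod.hom_ext fun X => LinearMap.congr_fun (TensorProduct.ext' (h X))

/-- A linear family of morphisms of modules, evaluated at an object, as a bilinear map. -/
def appAtBilin {G F : Mod K C} (θ : V →ₗ[K] (G ⟶ F)) (X : C) :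
    G.obj.obj X →ₗ[K] V →ₗ[K] F.obj.obj X where
  toFun x :=
    { toFun := fun v => appAt (θ v) X x
      map_add' := fun v w => by rw [map_add]; rfl
      map_smul' := fun r v => by rw [map_smul]; rfl }
  map_add' x y := LinearMap.ext fun v => map_add (appAt (θ v) X) x y
  map_smul' r x := LinearMap.ext fun v => map_smul (appAt (θ v) X) r x

/-- A linear family of morphisms of modules gives a morphism from the copower. -/
def copowerDesc {G F : Mod K C} (θ : V →ₗ[K] (G ⟶ F)) : copower G V ⟶ F :=
  Mod.homMk (F := copower G V) (fun X => TensorProduct.lift (appAtBilin θ X))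
    (fun X Y k => LinearMap.congr_fun
      (f := TensorProduct.lift (appAtBilin θ Y) ∘ₗ (act G k).rTensor V)
      (g := act F k ∘ₗ TensorProduct.lift (appAtBilin θ X))
      (TensorProduct.ext' fun x v => appAt_act (θ v) k x))

/-- The linear family of inclusions of a module into its copower. -/
def copowerIncl (G : Mod K C) : V →ₗ[K] (G ⟶ copower G V) where
  toFun v := Mod.homMk (G := copower G V)
    (fun X => (TensorProduct.mk K (G.obj.obj X) V).flip v) (fun _ _ _ _ => rfl)
  map_add' v w := Mod.hom_ext fun _ x => TensorProduct.tmul_add x v w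
  map_smul' r v := Mod.hom_ext fun _ x => TensorProduct.tmul_smul r x v

/-- A morphism from a copower extends along a morphism induced by `i : G ⟶ H` as soon as every
morphism from `G` extends along `i`. -/
lemma exists_copower_extension {G H F : Mod K C} (i : G ⟶ H)
    (hi : ∀ f : G ⟶ F, ∃ g : H ⟶ F, i ≫ g = f) (θ : V →ₗ[K] (G ⟶ F)) :
    ∃ θ' : V →ₗ[K] (H ⟶ F), ∀ v, i ≫ θ' v = θ v := by
  -- Precomposition with `i` is a surjective linear map and the vector space `V` is projective, so
  -- extensions can be chosen linearly in `v`.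
  obtain ⟨θ', h⟩ := Module.projective_lifting_property (Linear.leftComp K F i) θ hi
  exact ⟨θ', fun v => LinearMap.congr_fun h v⟩

/-- Maps out of `G ⊗ V` are linear families of maps out of `G` indexed by `V`. Such a family lifts
linearly because `V` is free. -/
lemma projective_copower (G : Mod K C) [Projective G] : Projective (copower G V) where
  factors {E F} f e _ := by
    obtain ⟨θ, h⟩ := Module.projective_lifting_property (Linear.rightComp K G e)
      (Linear.rightComp K G f ∘ₗ copowerIncl (V := V) G)
      (fun g => ⟨Projective.factorThru g e, Projective.factorThru_comp g e⟩)
    refine ⟨copowerDesc θ, copower_hom_ext fun X x v => ?_⟩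
    exact congrArg (fun t => appAt t X x) (LinearMap.congr_fun h v)

end ModuleTheory

section Representable

variable {K : Type v} [Field K] {C : Type u} [Category.{v} C] [Preadditive C] [Linear K C]

instance (X : C) : Projective (representable K X) :=
  projective_of_basis (representable K X) (ι := Unit) (fun _ => X) (fun _ => 𝟙 X) fun Y => by
    have h (g : Unit → (X ⟶ Y)) :
        ∑ i, act (representable K X) (g i) (𝟙 X : X ⟶ X) = (g () : X ⟶ Y) :=
      (Fintype.sum_unique _).trans (Category.id_comp _)
    constructor
    · intro g g' hg
      funext i
      exact (h g).symm.trans (hg.trans (h g'))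
    · intro f
      exact ⟨fun _ => f, h _⟩

variable (K) in
/-- The projection from a representable module to its quotient by the radical. -/
def toRadQuotient (X : C) : representable K X ⟶ radQuotient K X :=
  Mod.homMk (F := representable K X) (G := radQuotient K X)
    (fun Y => (radical (K := K) X Y).mkQ) (fun _ _ _ _ => rfl)

lemma appAt_toRadQuotient_eq_zero_iff {X Y : C} (h : X ⟶ Y) :
    appAt (toRadQuotient K X) Y h = 0 ↔ h ∈ radical (K := K) X Y :=
  Submodule.Quotient.mk_eq_zero _

end Representable

/-! ### Restriction to `U`, extension by zero, and modules vanishing on `U` -/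

section Recollement

universe u₁ u₂

variable {K : Type v} [Field K] {T : Type u₁} [Category.{v} T] [Preadditive T] [Linear K T]
  {U : Type u₂} [Category.{v} U] [Preadditive U] [Linear K U]
  (M : Tᵒᵖ ⥤ U ⥤ ModuleCat.{v} K) [IsBimodule M]

namespace TriMat

/-- The projection `Λ ⥤ U`, `[t 0; M u] ↦ u`. -/
def projU : TriMat M ⥤ U where
  obj A := A.u
  map a := a.2.2

instance : (projU M).Additive where
  map_add := rfl

instance : (projU M).Linear K where
  map_smul _ _ := rfl

variable {M}

omit [Preadditive T] [Linear K T] [Preadditive U] [Linear K U] [IsBimodule M] in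
lemma hom_ext {A B : TriMat M} {a b : A ⟶ B} (h₁ : a.1 = b.1) (h₂ : a.2.1 = b.2.1)
    (h₃ : a.2.2 = b.2.2) : a = b :=
  Prod.ext h₁ (Prod.ext h₂ h₃)

lemma bimodule_map_zero {t t' : T} : M.map (0 : t ⟶ t').op = 0 := by
  simpa using IsBimodule.map_smul (M := M) (0 : K) (0 : t ⟶ t')

lemma bimodule_eq_zero_of_isZero_left {t : T} (ht : IsZero t) {u : U}
    (m : (M.obj (op t)).obj u) : m = 0 := by
  have h : M.map (𝟙 t).op = 0 := by rw [ht.eq_of_src (𝟙 t) 0, bimodule_map_zero]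
  have := congrArg (fun f => (f.app u).hom m) h
  simpa using this

lemma bimodule_eq_zero_of_isZero_right {t : T} {u : U} (hu : IsZero u)
    (m : (M.obj (op t)).obj u) : m = 0 := by
  have := IsBimodule.additive (M := M) (op t)
  have h : (M.obj (op t)).map (𝟙 u) = 0 := by rw [hu.eq_of_src (𝟙 u) 0, Functor.map_zero]
  have := congrArg (fun f => f.hom m) h
  simpa using this

variable [HasZeroObject T]

/-- The morphism `[0 0; M u] ⟶ [t 0; M u]`. -/
def inU (A : TriMat M) : (inclU M).obj A.u ⟶ A := ((0 : (0 : T) ⟶ A.t), 0, 𝟙 A.u)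

/-- The morphism `[t 0; M u] ⟶ [0 0; M u]`. -/
def prU (A : TriMat M) : A ⟶ (inclU M).obj A.u := ((0 : A.t ⟶ (0 : T)), 0, 𝟙 A.u)

omit [Linear K T] [Preadditive U] [Linear K U] [IsBimodule M] in
lemma inU_prU (A : TriMat M) : inU A ≫ prU A = 𝟙 _ := by
  refine hom_ext ((isZero_zero T).eq_of_src _ _) ?_ (Category.id_comp _)
  change (M.map _).app _ 0 + (M.obj _).map _ 0 = 0
  simp

omit [Linear K T] [Preadditive U] [Linear K U] [IsBimodule M] in
lemma inU_inclU (u : U) : inU ((inclU M).obj u) = 𝟙 ((inclU M).obj u) :=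
  hom_ext ((isZero_zero T).eq_of_src _ _) rfl rfl

/-- This is what makes the counit a morphism of modules. The projections `prU` are not natural in
general, since they see the entry of `a` in `M`. -/
lemma inU_naturality {A B : TriMat M} (a : A ⟶ B) :
    (inclU M).map a.2.2 ≫ inU B = inU A ≫ a :=
  hom_ext ((isZero_zero T).eq_of_src _ _)
    ((bimodule_eq_zero_of_isZero_left (isZero_zero T) _).trans
      (bimodule_eq_zero_of_isZero_left (isZero_zero T) _).symm)
    ((Category.comp_id _).trans (Category.id_comp _).symm)

omit [Linear K T] [Preadditive U] [Linear K U] [IsBimodule M] in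
lemma comp_inclU_map {A : TriMat M} {u u' : U} (x : A ⟶ (inclU M).obj u) (g : u ⟶ u') :
    (x ≫ (inclU M).map g).2.1 = (M.obj (op A.t)).map g x.2.1 :=
  (congrArg (fun t => t + (M.obj (op A.t)).map g x.2.1)
    (map_zero ((M.map x.1.op).app u').hom)).trans (zero_add _)

/-- The diagonal morphisms of `Λ`. -/
def diag (A B : TriMat M) : (A.t ⟶ B.t) × (A.u ⟶ B.u) →+ (A ⟶ B) where
  toFun f := (f.1, 0, f.2)
  map_zero' := rfl
  map_add' _ _ := Prod.ext rfl (Prod.ext (add_zero _).symm rfl)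

omit [Linear K T] [Linear K U] [IsBimodule M] [HasZeroObject T] in
lemma diag_comp_diag {A B C : TriMat M} (f : (A.t ⟶ B.t) × (A.u ⟶ B.u))
    (g : (B.t ⟶ C.t) × (B.u ⟶ C.u)) :
    diag A B f ≫ diag B C g = diag A C (f.1 ≫ g.1, f.2 ≫ g.2) := by
  refine hom_ext rfl ?_ rfl
  change (M.map _).app _ 0 + (M.obj _).map _ 0 = 0
  simp

end TriMat

open TriMat

variable [HasZeroObject T]

/-- Extension by zero of `U`-modules to `Λ`-modules is left adjoint to restriction. -/
def extendAdj : restrict K (projU M) ⊣ restrict K (inclU M) :=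
  Adjunction.mkOfUnitCounit
    { unit :=
        { app := fun G => Mod.homMk (F := G)
            (G := (restrict K (inclU M)).obj ((restrict K (projU M)).obj G))
            (fun _ => LinearMap.id) (fun _ _ _ _ => rfl) }
      counit :=
        { app := fun F => Mod.homMk
            (F := (restrict K (projU M)).obj ((restrict K (inclU M)).obj F)) (G := F)
            (fun A => act F (inU A))
            (fun A B a x => (act_comp F _ _ x).symm.trans
              ((congrArg (fun t => act F t x) (inU_naturality a)).trans (act_comp F _ _ x)))
          naturality := fun F G f => Mod.hom_ext fun A x => (appAt_act f (inU A) x).symm }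
      left_triangle := by
        ext G : 2
        exact Mod.hom_ext fun A x => act_id G x
      right_triangle := by
        ext F : 2
        exact Mod.hom_ext fun u x =>
          (congrArg (fun t => act F t x) (inU_inclU u)).trans (act_id F x) }

variable {M}

/-- `inU A` is split by `prU A`, which gives a retraction at each object, though in general not a
retraction of modules. -/
lemma extendAdj_counit_injective (F : Mod K (TriMat M)) (A : TriMat M) :
    Function.Injective (appAt ((extendAdj M).counit.app F) A) :=
  Function.LeftInverse.injective (g := act F (prU A)) fun x =>
    (act_comp F (inU A) (prU A) x).symm.trans
      ((congrArg (fun t => act F t x) (inU_prU A)).trans (act_id F x))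

instance (F : Mod K (TriMat M)) : Mono ((extendAdj M).counit.app F) :=
  Mod.mono_of_injective _ (extendAdj_counit_injective F)

lemma extendAdj_counit_shortExact (F : Mod K (TriMat M)) :
    (ShortComplex.mk ((extendAdj M).counit.app F) (cokernel.π ((extendAdj M).counit.app F))
      (cokernel.condition _)).ShortExact :=
  { exact := ShortComplex.exact_of_g_is_cokernel _ (cokernelIsCokernel _) }

/-- On objects of `U` the counit is the identity. -/
lemma subsingleton_cokernel_counit (F : Mod K (TriMat M)) (u : U) :
    Subsingleton ((cokernel ((extendAdj M).counit.app F)).obj.obj ((inclU M).obj u)) := by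
  refine subsingleton_of_forall_eq 0 fun z => ?_
  obtain ⟨x, rfl⟩ := appAt_surjective (cokernel.π ((extendAdj M).counit.app F)) _ z
  have hx : x = appAt ((extendAdj M).counit.app F) ((inclU M).obj u) x :=
    (act_id F x).symm.trans (congrArg (fun t => act F t x) (inU_inclU (M := M) u)).symm
  exact (congrArg (appAt (cokernel.π ((extendAdj M).counit.app F)) _) hx).trans
    (show appAt ((extendAdj M).counit.app F ≫ cokernel.π ((extendAdj M).counit.app F))
      ((inclU M).obj u) x = 0 by rw [cokernel.condition]; rfl)

/-- The object `s` of `Λ` generates `T` additively: the identity of any object of `Λ` is, up to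
morphisms factoring through its `U`-part, a sum of endomorphisms factoring through `s`. -/
def GeneratesT (s : TriMat M) : Prop :=
  ∀ A : TriMat M, ∃ (n : ℕ) (k : Fin n → (A ⟶ s)) (h : Fin n → (s ⟶ A)),
    𝟙 A = ∑ i, k i ≫ h i + prU A ≫ inU A

omit [Linear K T] [Linear K U] [IsBimodule M] in
lemma GeneratesT.of_t {s : TriMat M}
    (hs : ∀ t : T, ∃ (n : ℕ) (k : Fin n → (t ⟶ s.t)) (h : Fin n → (s.t ⟶ t)),
      𝟙 t = ∑ i, k i ≫ h i) : GeneratesT s := by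
  intro A
  obtain ⟨n, k, h, e⟩ := hs A.t
  refine ⟨n, fun i => diag A s (k i, 0), fun i => diag s A (h i, 0), ?_⟩
  have h₁ : prU A ≫ inU A = diag A A (0, 𝟙 A.u) :=
    (diag_comp_diag (B := (inclU M).obj A.u) (0, 𝟙 A.u) (0, 𝟙 A.u)).trans
      (congrArg _ (Prod.ext zero_comp (Category.comp_id _)))
  have h₂ : 𝟙 A = diag A A (𝟙 A.t, 𝟙 A.u) := rfl
  rw [h₁, h₂]
  simp only [diag_comp_diag, ← map_sum, ← map_add]
  congr 1
  refine Prod.ext ?_ ?_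
  · simpa [Prod.fst_sum] using e
  · simp [Prod.snd_sum]

/-- Element form of the decomposition of the identity: `x` is determined by its images at `s` and on
`U`, with the same morphisms for every module. -/
lemma GeneratesT.decomp {s : TriMat M} (hs : GeneratesT s) (A : TriMat M) :
    ∃ (n : ℕ) (k : Fin n → (A ⟶ s)) (h : Fin n → (s ⟶ A)),
      ∀ (F : Mod K (TriMat M)) (x : F.obj.obj A),
        x = ∑ i, act F (h i) (act F (k i) x) + act F (inU A) (act F (prU A) x) := by
  obtain ⟨n, k, h, e⟩ := hs A
  refine ⟨n, k, h, fun F x => ?_⟩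
  have := congrArg (fun t => act F t x) e
  simpa only [act_id, act_add, act_sum, act_comp] using this

variable {s : TriMat M}

/-- The presentation of a module vanishing on `U` by a copower of the module represented
by `s`. -/
lemma copower_shortExact (hs : GeneratesT s) (hend : ∀ f : s ⟶ s, ∃ c : K, f = c • 𝟙 s)
    (Z : Mod K (TriMat M)) (hZ : ∀ u, Subsingleton (Z.obj.obj ((inclU M).obj u))) :
    ∃ w, (ShortComplex.mk ((extendAdj M).counit.app (copower (representable K s) (Z.obj.obj s)))
      (copowerDesc (yonedaMap Z s)) w).ShortExact := by
  have hw : (extendAdj M).counit.app (copower (representable K s) (Z.obj.obj s)) ≫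
      copowerDesc (yonedaMap Z s) = 0 := Mod.hom_ext fun A x => by
    have h₁ : appAt (copowerDesc (yonedaMap Z s)) ((inclU M).obj A.u) x = 0 :=
      (hZ A.u).elim _ _
    exact (appAt_act (copowerDesc (yonedaMap Z s)) (inU A) x).trans
      ((congrArg (act Z (inU A)) h₁).trans (map_zero _))
  -- At `s` the endomorphisms are scalars, so every tensor has the form `𝟙 ⊗ v` and is sent to `v`.
  have hinj : ∀ x, appAt (copowerDesc (yonedaMap Z s)) s x = 0 → x = 0 := by
    have hx (x : (copower (representable K s) (Z.obj.obj s)).obj.obj s) :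
        ∃ v : Z.obj.obj s, x = TensorProduct.tmul K (𝟙 s : s ⟶ s) v := by
      refine TensorProduct.induction_on x ⟨0, (TensorProduct.tmul_zero _ _).symm⟩ ?_ ?_
      · intro (f : s ⟶ s) v
        obtain ⟨c, rfl⟩ := hend f
        exact ⟨c • v, TensorProduct.smul_tmul (R := K) (M := s ⟶ s) c (𝟙 s) v⟩
      · rintro _ _ ⟨v, rfl⟩ ⟨w, rfl⟩
        exact ⟨v + w, (TensorProduct.tmul_add _ _ _).symm⟩
    intro x h
    obtain ⟨v, rfl⟩ := hx x
    have : v = 0 := (act_id Z v).symm.trans h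
    rw [this]
    exact TensorProduct.tmul_zero _ _
  refine ⟨hw, Mod.shortExact_of_forall _ (extendAdj_counit_injective _) ?_ ?_⟩
  · intro A x hx
    obtain ⟨n, k, h, e⟩ := hs.decomp A
    refine ⟨act (copower (representable K s) (Z.obj.obj s)) (prU A) x, ?_⟩
    -- An element of the kernel has zero components at `s`, so only its `U`-part survives in the
    -- decomposition, and that lies in the image of the counit.
    have hk (i : Fin n) : act (copower (representable K s) (Z.obj.obj s)) (k i) x = 0 := by
      apply hinj
      rw [appAt_act]
      exact (congrArg (act Z (k i)) hx).trans (map_zero _)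
    have := e (copower (representable K s) (Z.obj.obj s)) x
    simp only [hk, map_zero, Finset.sum_const_zero, zero_add] at this
    exact this.symm
  · intro A z
    obtain ⟨n, k, h, e⟩ := hs.decomp A
    refine ⟨∑ i, TensorProduct.tmul K (h i) (act Z (k i) z), ?_⟩
    have h₀ : act Z (prU A) z = 0 := (hZ A.u).elim _ _
    have h₁ := e Z z
    rw [h₀, map_zero, add_zero] at h₁
    exact (map_sum (appAt (copowerDesc (yonedaMap Z s)) A) _ _).trans h₁.symm

/-- A radical morphism composes to zero with every morphism back to `s`, so the decomposition of `𝟙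
A` leaves only the part through `U`. Conversely, nothing nonzero goes from `U` to `s`. This
identifies `rad P` with `LRP`. -/
lemma radical_eq_range (hs : GeneratesT s) (hend : ∀ f : s ⟶ s, ∃ c : K, f = c • 𝟙 s)
    (hsu : IsZero s.u) {A : TriMat M} (h : s ⟶ A) :
    h ∈ radical (K := K) s A ↔ ∃ y : s ⟶ (inclU M).obj A.u, y ≫ inU A = h := by
  constructor
  · intro hh
    have h₀ (g : A ⟶ s) : h ≫ g = 0 := by
      obtain ⟨c, hc⟩ := hend (h ≫ g)
      by_cases hc₀ : c = 0
      · rw [hc, hc₀, zero_smul]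
      -- A nonzero scalar would make `0 = 𝟙 s - h ≫ (c⁻¹ • g)` invertible; then `𝟙 s = 0`, and `h ≫
      -- g` vanishes anyway.
      · have h₁ := hh (c⁻¹ • g)
        rw [Linear.comp_smul, hc, smul_smul, inv_mul_cancel₀ hc₀, one_smul, sub_self] at h₁
        have h₂ : 𝟙 s = 0 := by
          rw [← IsIso.hom_inv_id (0 : s ⟶ s), zero_comp]
        rw [hc, h₂, smul_zero]
    obtain ⟨n, k, h', e⟩ := hs A
    refine ⟨h ≫ prU A, ?_⟩
    have := congrArg (h ≫ ·) e
    simp only [Category.comp_id, Preadditive.comp_add, Preadditive.comp_sum,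
      ← Category.assoc, h₀, zero_comp, Finset.sum_const_zero, zero_add] at this
    exact this.symm
  · rintro ⟨y, rfl⟩ g
    have : inU A ≫ g = 0 := hom_ext ((isZero_zero T).eq_of_src _ _)
      ((bimodule_eq_zero_of_isZero_left (isZero_zero T) _).trans rfl) (hsu.eq_of_tgt _ _)
    rw [Category.assoc, this, comp_zero, sub_zero]
    infer_instance

lemma radQuotient_shortExact (hs : GeneratesT s) (hend : ∀ f : s ⟶ s, ∃ c : K, f = c • 𝟙 s)
    (hsu : IsZero s.u) :
    ∃ w, (ShortComplex.mk ((extendAdj M).counit.app (representable K s))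
      (toRadQuotient K s) w).ShortExact := by
  refine ⟨Mod.hom_ext fun A (x : s ⟶ (inclU M).obj A.u) => ?_,
    Mod.shortExact_of_forall _ (extendAdj_counit_injective _) ?_ ?_⟩
  · exact (appAt_toRadQuotient_eq_zero_iff (K := K) (x ≫ inU A)).2
      ((radical_eq_range hs hend hsu _).2 ⟨x, rfl⟩)
  · intro A (x : s ⟶ A) hx
    exact (radical_eq_range hs hend hsu _).1 ((appAt_toRadQuotient_eq_zero_iff (K := K) x).1 hx)
  · intro A
    exact Submodule.mkQ_surjective _

/-- For `V = K` the obstruction to extending lies in `Ext^1(S, Y)`, by the sequence `0 → LRP → P → S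
→ 0`. Linear choice of extensions gives arbitrary `V`. -/
lemma exists_extension_of_ext_radQuotient (hs : GeneratesT s)
    (hend : ∀ f : s ⟶ s, ∃ c : K, f = c • 𝟙 s) (hsu : IsZero s.u) {Y : Mod K (TriMat M)}
    (hY : ∀ e : Abelian.Ext (radQuotient K s) Y 1, e = 0)
    (V : Type v) [AddCommGroup V] [Module K V]
    (f : (restrict K (projU M)).obj ((restrict K (inclU M)).obj
      (copower (representable K s) V)) ⟶ Y) :
    ∃ g, (extendAdj M).counit.app (copower (representable K s) V) ≫ g = f := by
  obtain ⟨w, hS⟩ := radQuotient_shortExact (K := K) hs hend hsu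
  have h₁ (f : (restrict K (projU M)).obj ((restrict K (inclU M)).obj
      (representable K s)) ⟶ Y) :
      ∃ g, (extendAdj M).counit.app (representable K s) ≫ g = f := by
    obtain ⟨x, hx⟩ := Abelian.Ext.contravariant_sequence_exact₁ hS Y (Abelian.Ext.mk₀ f)
      (add_zero 1) (hY _)
    obtain ⟨g, rfl⟩ := (Abelian.Ext.mk₀_bijective _ _).2 x
    rw [Abelian.Ext.mk₀_comp_mk₀] at hx
    exact ⟨g, (Abelian.Ext.mk₀_bijective _ _).1 hx⟩
  -- The family sends `v` to the restriction of `f` to the copy `LRP ⊗ v`.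
  obtain ⟨θ, hθ⟩ := exists_copower_extension _ h₁
    (Linear.rightComp K _ f ∘ₗ
      ((restrict K (inclU M) ⋙ restrict K (projU M)).mapLinearMap K ∘ₗ
        copowerIncl (V := V) (representable K s)))
  refine ⟨copowerDesc θ, Mod.hom_ext fun A => LinearMap.congr_fun (TensorProduct.ext'
    fun x v => ?_)⟩
  exact congrArg (fun t => appAt t A x) (hθ v)

variable (hs : GeneratesT s) (hend : ∀ f : s ⟶ s, ∃ c : K, f = c • 𝟙 s)

include hs hend

/-- As `P ⊗ V` is projective, `e` is the connecting image of a map `LR(P ⊗ V) ⟶ Y`. That map extends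
to `P ⊗ V`, so its connecting image is zero. -/
lemma ext_eq_zero_of_radQuotient (hsu : IsZero s.u) {Y : Mod K (TriMat M)}
    (hY : ∀ e : Abelian.Ext (radQuotient K s) Y 1, e = 0)
    (Z : Mod K (TriMat M)) (hZ : ∀ u, Subsingleton (Z.obj.obj ((inclU M).obj u)))
    (e : Abelian.Ext Z Y 1) : e = 0 := by
  obtain ⟨w, hS⟩ := copower_shortExact hs hend Z hZ
  have : Projective (copower (representable K s) (Z.obj.obj s)) := projective_copower _
  obtain ⟨x, rfl⟩ := Abelian.Ext.contravariant_sequence_exact₃ hS Y e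
    (Abelian.Ext.eq_zero_of_projective _) (add_zero 1)
  obtain ⟨f, rfl⟩ := (Abelian.Ext.mk₀_bijective _ _).2 x
  obtain ⟨g, rfl⟩ := exists_extension_of_ext_radQuotient hs hend hsu hY _ f
  rw [← Abelian.Ext.mk₀_comp_mk₀]
  exact hS.extClass_comp_assoc _

variable [Projective ((restrict K (inclU M)).obj (representable K s))]

/-- The copower presentation is a projective resolution of length one: `R` commutes with copowers,
and `L` preserves projectives because its right adjoint `R` is exact. -/
lemma hasProjectiveDimensionLT_two (Z : Mod K (TriMat M))
    (hZ : ∀ u, Subsingleton (Z.obj.obj ((inclU M).obj u))) : HasProjectiveDimensionLT Z 2 := by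
  obtain ⟨w, hS⟩ := copower_shortExact hs hend Z hZ
  have : Projective (copower (representable K s) (Z.obj.obj s)) := projective_copower _
  have h : Projective ((restrict K (inclU M)).obj (copower (representable K s) (Z.obj.obj s))) :=
    projective_copower (V := Z.obj.obj s) ((restrict K (inclU M)).obj (representable K s))
  have : Projective ((restrict K (projU M)).obj ((restrict K (inclU M)).obj
      (copower (representable K s) (Z.obj.obj s)))) := (extendAdj M).map_projective _ h
  have h₁ : HasProjectiveDimensionLT ((restrict K (projU M)).obj ((restrict K (inclU M)).obj
      (copower (representable K s) (Z.obj.obj s)))) 1 := inferInstance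
  have h₂ : HasProjectiveDimensionLT (copower (representable K s) (Z.obj.obj s)) (1 + 1) :=
    inferInstance
  exact hS.hasProjectiveDimensionLT_X₃ 1 h₁ h₂

/-- The obstruction lies in degree `1 + j ≥ 2`, beyond the projective dimension of the cokernel of
the counit. -/
lemma mapExt_restrict_surjective (X Y : Mod K (TriMat M)) {j : ℕ} (hj : 1 ≤ j) :
    Function.Surjective ((restrict K (inclU M)).mapExtLinearMap K X Y j) := by
  have := hasProjectiveDimensionLT_two hs hend _ (subsingleton_cokernel_counit X)
  exact Abelian.Ext.mapExactFunctor_surjective_of_adjunction (extendAdj M)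
    (extendAdj_counit_shortExact X) fun e => e.eq_zero_of_hasProjectiveDimensionLT 2 (by lia)

lemma mapExt_restrict_bijective (X Y : Mod K (TriMat M)) {j : ℕ} (hj : 2 ≤ j) :
    Function.Bijective ((restrict K (inclU M)).mapExtLinearMap K X Y j) := by
  have := hasProjectiveDimensionLT_two hs hend _ (subsingleton_cokernel_counit X)
  exact ⟨Abelian.Ext.mapExactFunctor_injective_of_adjunction (extendAdj M)
      (extendAdj_counit_shortExact X) fun e => e.eq_zero_of_hasProjectiveDimensionLT 2 hj,
    mapExt_restrict_surjective hs hend X Y (by lia)⟩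

lemma mapExt_restrict_bijective_one (hsu : IsZero s.u) (X Y : Mod K (TriMat M))
    (hY : ∀ e : Abelian.Ext (radQuotient K s) Y 1, e = 0) :
    Function.Bijective ((restrict K (inclU M)).mapExtLinearMap K X Y 1) :=
  ⟨Abelian.Ext.mapExactFunctor_injective_of_adjunction (extendAdj M)
      (extendAdj_counit_shortExact X)
      (ext_eq_zero_of_radQuotient hs hend hsu hY _ (subsingleton_cokernel_counit X)),
    mapExt_restrict_surjective hs hend X Y le_rfl⟩

end Recollement

/-! ### Linear combinations of paths and left division by an arrow -/

section Paths

variable (K : Type u) [Field K] {Q : Type u} [Quiver.{u} Q]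

/-- A vertex as an object of the linearized category of paths. -/
abbrev freeVertex (q : Q) : Free K (Paths Q) := Free.of K (C := Paths Q) q

/-- A path as a morphism of the linearized category of paths. -/
def freePath {a b : Q} (p : Quiver.Path a b) : freeVertex K a ⟶ freeVertex K b :=
  Finsupp.single p 1

variable {K}

lemma freePath_comp {a b c : Q} (p : Quiver.Path a b) (q : Quiver.Path b c) :
    freePath K (p.comp q) = freePath K p ≫ freePath K q :=
  ((Free.single_comp_single K (C := Paths Q) (X := a) (Y := b) (Z := c) p q 1 1).trans
    (by rw [mul_one]; rfl)).symm

@[elab_as_elim]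
lemma free_induction {a b : Q} {P : (freeVertex K a ⟶ freeVertex K b) → Prop}
    (f : freeVertex K a ⟶ freeVertex K b) (h₀ : P 0) (hadd : ∀ f g, P f → P g → P (f + g))
    (hp : ∀ (r : K) (p : Quiver.Path a b), P (r • freePath K p)) : P f := by
  refine Finsupp.induction_linear (motive := P) f h₀ hadd fun p r => ?_
  have : r • freePath K p = Finsupp.single p r :=
    (Finsupp.smul_single r p 1).trans (by rw [smul_eq_mul, mul_one])
  rw [← this]
  exact hp r p

/-- A path determines its first arrow. Paths grow at their end, so the induction strips last arrows
from `p` and `p'`, kept in step by the equality of lengths. -/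
lemma sigma_eq_of_toPath_comp_eq {a b x y : Q} {e : a ⟶ x} {f : a ⟶ y} {p : Quiver.Path x b}
    {p' : Quiver.Path y b} (h : e.toPath.comp p = f.toPath.comp p') :
    (⟨x, e⟩ : Σ x : Q, a ⟶ x) = ⟨y, f⟩ := by
  have hl := congrArg Quiver.Path.length h
  simp only [Quiver.Path.length_comp, Quiver.Path.length_toPath, add_right_inj] at hl
  induction p with
  | nil =>
    cases p' with
    | nil =>
      simp only [Quiver.Path.comp_nil] at h
      rw [eq_of_heq (Quiver.Path.hom_heq_of_cons_eq_cons h)]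
    | cons q g => simp at hl
  | cons q g ih =>
    cases p' with
    | nil => simp at hl
    | cons q' g' =>
      simp only [Quiver.Path.comp_cons] at h
      obtain rfl := Quiver.Path.obj_eq_of_cons_eq_cons h
      exact ih (eq_of_heq (Quiver.Path.heq_of_cons_eq_cons h)) (by simpa using hl)

/-- Left division by an arrow in the linearized category of paths. -/
def leftDiv {a x : Q} (e : a ⟶ x) (b : Q) :
    (freeVertex K a ⟶ freeVertex K b) →ₗ[K] (freeVertex K x ⟶ freeVertex K b) :=
  Finsupp.lcomapDomain (fun p : Quiver.Path x b => e.toPath.comp p)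
    (Quiver.Path.comp_injective_right _)

lemma leftDiv_comp_self {a x : Q} (e : a ⟶ x) {b : Q} (f : freeVertex K x ⟶ freeVertex K b) :
    leftDiv e b (freePath K e.toPath ≫ f) = f := by
  induction f using free_induction with
  | h₀ => rw [comp_zero, map_zero]
  | hadd f g hf hg =>
    rw [Preadditive.comp_add, map_add, hf, hg]
  | hp r p =>
    rw [Linear.comp_smul, map_smul, ← freePath_comp]
    exact congrArg (r • ·) (Finsupp.comapDomain_single _ _ _ _)

lemma leftDiv_comp_of_ne {a : Q} {α β : Σ x : Q, a ⟶ x} (h : α ≠ β) {b : Q}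
    (f : freeVertex K β.1 ⟶ freeVertex K b) :
    leftDiv α.2 b (freePath K β.2.toPath ≫ f) = 0 := by
  induction f using free_induction with
  | h₀ => rw [comp_zero, map_zero]
  | hadd f g hf hg =>
    rw [Preadditive.comp_add, map_add, hf, hg, add_zero]
  | hp r p =>
    rw [Linear.comp_smul, map_smul, ← freePath_comp]
    refine (congrArg (r • ·) (Finsupp.ext fun p' => ?_)).trans (smul_zero r)
    exact Finsupp.single_eq_of_ne fun h' => h (sigma_eq_of_toPath_comp_eq h')

variable {a : Q} [Fintype (Σ x : Q, a ⟶ x)]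

lemma sum_comp_leftDiv {b : Q} (hb : b ≠ a) (f : freeVertex K a ⟶ freeVertex K b) :
    ∑ α : (Σ x : Q, a ⟶ x), freePath K α.2.toPath ≫ leftDiv α.2 b f = f := by
  induction f using free_induction with
  | h₀ => simp
  | hadd f g hf hg =>
    simp only [map_add, Preadditive.comp_add, Finset.sum_add_distrib, hf, hg]
  | hp r p =>
    simp only [map_smul, Linear.comp_smul, ← Finset.smul_sum]
    congr 1
    -- Since `b ≠ a`, the path is not trivial and has a first arrow.
    obtain ⟨c, e, p', rfl, -⟩ := p.length_ne_zero_iff_eq_comp.1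
      fun h => hb (Quiver.Path.eq_of_length_zero p h).symm
    rw [freePath_comp, Finset.sum_eq_single (⟨c, e⟩ : Σ x : Q, a ⟶ x)]
    · rw [leftDiv_comp_self]
    · intro β _ hβ
      rw [leftDiv_comp_of_ne (β := ⟨c, e⟩) hβ, comp_zero]
    · simp

/-- The first arrow of a product is that of its left factor. This needs `b ≠ a`: for `f = 𝟙` the
quotient of `f` is zero, while that of `g` need not be. -/
lemma leftDiv_comp {b c : Q} (hb : b ≠ a) (f : freeVertex K a ⟶ freeVertex K b)
    (g : freeVertex K b ⟶ freeVertex K c) (α : Σ x : Q, a ⟶ x) :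
    leftDiv α.2 c (f ≫ g) = leftDiv α.2 b f ≫ g := by
  conv_lhs => rw [← sum_comp_leftDiv hb f, Preadditive.sum_comp, map_sum,
    Finset.sum_eq_single α (fun β _ hβ => by
      rw [Category.assoc, leftDiv_comp_of_ne hβ.symm]) (by simp)]
  rw [Category.assoc, leftDiv_comp_self]

variable {ρ : ∀ a b : Q, Set (Quiver.Path a b →₀ K)}

/-- If no relation starts at `a`, left division by an arrow starting at `a` preserves the ideal
of relations. -/
lemma leftDiv_mem_idealSpan (hρ : ∀ b, ρ a b = ∅) {b : Q} {f : freeVertex K a ⟶ freeVertex K b}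
    (hf : f ∈ idealSpan K (pathRel ρ) (freeVertex K a) (freeVertex K b)) (α : Σ x : Q, a ⟶ x) :
    leftDiv α.2 b f ∈ idealSpan K (pathRel ρ) (freeVertex K α.1) (freeVertex K b) := by
  refine (Submodule.span_le (p := (idealSpan K (pathRel ρ) (freeVertex K α.1)
    (freeVertex K b)).comap (leftDiv α.2 b))).2 ?_ hf
  rintro _ ⟨(c : Q), (d : Q), p, r, q, hr, rfl⟩
  -- No relation starts at `a`, so the prefix `p` contains no trivial path. Dividing `p ≫ r ≫ q`
  -- then only divides `p`, and the result still contains the factor `r`.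
  have hc : c ≠ a := by
    rintro rfl
    exact Set.eq_empty_iff_forall_notMem.1 (hρ d) r hr
  have : leftDiv α.2 b (p ≫ r ≫ q) = leftDiv α.2 c p ≫ r ≫ q := leftDiv_comp hc p (r ≫ q) α
  exact Submodule.subset_span ⟨c, d, leftDiv α.2 c p, r, q, hr, this⟩

end Paths

/-! ### Unique expansion along arrows modulo relations -/

section PathCategory

variable {K : Type u} [Field K] {Q : Type u} [Quiver.{u} Q]
  (ρ : ∀ a b : Q, Set (Quiver.Path a b →₀ K))

/-- The class of a linear combination of paths as a morphism of the path category. -/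
def pathMap {a b : Q} : (freeVertex K a ⟶ freeVertex K b) →ₗ[K] (vertex ρ a ⟶ vertex ρ b) where
  toFun f := (Mat_.embedding (VertexCat ρ)).map
    ((Quotient.functor (idealRel K (pathRel ρ))).map f)
  map_add' _ _ := rfl
  map_smul' _ _ := rfl

lemma pathMap_comp {a b c : Q} (f : freeVertex K a ⟶ freeVertex K b)
    (g : freeVertex K b ⟶ freeVertex K c) : pathMap ρ (f ≫ g) = pathMap ρ f ≫ pathMap ρ g :=
  (congrArg (Mat_.embedding (VertexCat ρ)).map
    ((Quotient.functor (idealRel K (pathRel ρ))).map_comp f g)).trans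
      ((Mat_.embedding (VertexCat ρ)).map_comp _ _)

lemma pathMap_id (a : Q) : pathMap ρ (𝟙 (freeVertex K a)) = 𝟙 (vertex ρ a) :=
  (congrArg (Mat_.embedding (VertexCat ρ)).map
    ((Quotient.functor (idealRel K (pathRel ρ))).map_id _)).trans
      ((Mat_.embedding (VertexCat ρ)).map_id _)

lemma pathMap_surjective {a b : Q} :
    Function.Surjective (pathMap ρ : (freeVertex K a ⟶ freeVertex K b) →ₗ[K] _) := fun f => by
  obtain ⟨g, rfl⟩ := (Mat_.embedding (VertexCat ρ)).map_surjective f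
  obtain ⟨h, rfl⟩ := (Quotient.functor (idealRel K (pathRel ρ))).map_surjective g
  exact ⟨h, rfl⟩

lemma pathMap_eq_zero_iff {a b : Q} (f : freeVertex K a ⟶ freeVertex K b) :
    pathMap ρ f = 0 ↔ f ∈ idealSpan K (pathRel ρ) (freeVertex K a) (freeVertex K b) := by
  have h₁ : pathMap ρ f = 0 ↔ (Quotient.functor (idealRel K (pathRel ρ))).map f =
      (Quotient.functor (idealRel K (pathRel ρ))).map 0 :=
    ⟨fun h => (Mat_.embedding (VertexCat ρ)).map_injective h,
      fun h => congrArg (Mat_.embedding (VertexCat ρ)).map h⟩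
  rw [h₁, Quotient.functor_map_eq_iff]
  change f - 0 ∈ _ ↔ _
  rw [sub_zero]

/-- An arrow as a morphism of the path category. -/
def arrow {a b : Q} (e : a ⟶ b) : vertex ρ a ⟶ vertex ρ b := pathMap ρ (freePath K e.toPath)

variable {a : Q} [Fintype (Σ x : Q, a ⟶ x)]

/-- Every morphism from `a` to `W` has a unique expansion along the arrows starting at `a`. -/
def HasUniqueExpansion (a : Q) [Fintype (Σ x : Q, a ⟶ x)] (W : PathCat ρ) : Prop :=
  Function.Bijective fun g : (∀ α : (Σ x : Q, a ⟶ x), vertex ρ α.1 ⟶ W) =>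
    ∑ α, arrow ρ α.2 ≫ g α

variable {ρ}

/-- Left division by an arrow reads off its coefficient and preserves the ideal, so an expansion
that vanishes modulo relations has coefficients that vanish modulo relations. -/
lemma hasUniqueExpansion_vertex (hρ : ∀ b, ρ a b = ∅) {b : Q} (hb : b ≠ a) :
    HasUniqueExpansion ρ a (vertex ρ b) := by
  constructor
  · intro g g' h
    choose f hf using fun α => pathMap_surjective ρ (g α - g' α)
    have h₁ : pathMap ρ (∑ α : (Σ x : Q, a ⟶ x), freePath K α.2.toPath ≫ f α) = 0 := by
      simp only [map_sum, pathMap_comp, hf, Preadditive.comp_sub, Finset.sum_sub_distrib]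
      exact sub_eq_zero.2 h
    rw [pathMap_eq_zero_iff] at h₁
    funext β
    have h₂ := leftDiv_mem_idealSpan hρ h₁ β
    rw [map_sum, Finset.sum_eq_single β (fun α _ hα => leftDiv_comp_of_ne hα.symm _) (by simp),
      leftDiv_comp_self, ← pathMap_eq_zero_iff, hf, sub_eq_zero] at h₂
    exact h₂
  · intro f
    obtain ⟨f, rfl⟩ := pathMap_surjective ρ f
    refine ⟨fun α => pathMap ρ (leftDiv α.2 b f), ?_⟩
    simp only [arrow, ← pathMap_comp, ← map_sum, sum_comp_leftDiv hb]

/-- Unique expansion is tested on the components of a direct sum and passes to retracts. -/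
lemma HasUniqueExpansion.of_addClosure {P : ObjectProperty (PathCat ρ)}
    (hP : ∀ W, P W → HasUniqueExpansion ρ a W) {W : PathCat ρ} (hW : addClosure P W) :
    HasUniqueExpansion ρ a W := by
  obtain ⟨n, Z, hZ, ⟨r⟩⟩ := hW
  constructor
  · intro g g' h
    funext α
    rw [← cancel_mono r.i]
    refine biproduct.hom_ext _ _ fun k => ?_
    refine congrFun ((hP _ (hZ k)).1 (a₁ := fun α => (g α ≫ r.i) ≫ biproduct.π Z k)
      (a₂ := fun α => (g' α ≫ r.i) ≫ biproduct.π Z k) ?_) α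
    have := congrArg (fun t => t ≫ r.i ≫ biproduct.π Z k) h
    simpa only [Preadditive.sum_comp, Category.assoc] using this
  · intro f
    choose g hg using fun k => (hP _ (hZ k)).2 (f ≫ r.i ≫ biproduct.π Z k)
    refine ⟨fun α => ∑ k, g k α ≫ biproduct.ι Z k ≫ r.r, ?_⟩
    simp only at hg
    simp only [Preadditive.comp_sum, ← Category.assoc]
    rw [Finset.sum_comm]
    simp only [← Preadditive.sum_comp, hg]
    calc (∑ k, (f ≫ r.i ≫ biproduct.π Z k) ≫ biproduct.ι Z k) ≫ r.r
        = f ≫ r.i ≫ (∑ k, biproduct.π Z k ≫ biproduct.ι Z k) ≫ r.r := by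
          simp only [Preadditive.sum_comp, Preadditive.comp_sum, Category.assoc]
      _ = f := by rw [biproduct.total, Category.id_comp, r.retract, Category.comp_id]

end PathCategory

/-! ### The source vertex: endomorphisms, generation of `T`, projectivity of `RP` -/

section Main

variable {K : Type u} [Field K] {Q : Type u} [Quiver.{u} Q]
  (ρ : ∀ a b : Q, Set (Quiver.Path a b →₀ K)) {star : Q}

/-- No arrow ends at a source, so the only path from `star` to itself is trivial; the other matrix
entries vanish with the zero `U`-part. -/
lemma starObj_end (hstar : ∀ a : Q, IsEmpty (a ⟶ star)) (f : starObj ρ star ⟶ starObj ρ star) :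
    ∃ c : K, f = c • 𝟙 _ := by
  have hf := pathMap_surjective ρ (a := star) (b := star) f.1.hom
  obtain ⟨g, hg⟩ := hf
  have hnil (p : Quiver.Path star star) : p = .nil := by
    cases p with
    | nil => rfl
    | cons p e => exact ((hstar _).false e).elim
  have hg' : ∃ c : K, g = c • 𝟙 (freeVertex K star) := by
    clear hg
    induction g using free_induction with
    | h₀ => exact ⟨0, (zero_smul _ _).symm⟩
    | hadd f g hf hg =>
      obtain ⟨⟨c, rfl⟩, ⟨d, rfl⟩⟩ := And.intro hf hg
      exact ⟨c + d, (add_smul _ _ _).symm⟩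
    | hp r p =>
      rw [hnil p]
      exact ⟨r, rfl⟩
  obtain ⟨c, rfl⟩ := hg'
  refine ⟨c, TriMat.hom_ext ?_ ?_ ((isZero_zero _).eq_of_src _ _)⟩
  · apply ObjectProperty.hom_ext
    rw [← hg, map_smul, pathMap_id]
    rfl
  · exact (TriMat.bimodule_eq_zero_of_isZero_right (M := bimod ρ star) (isZero_zero _) _).trans
      (TriMat.bimodule_eq_zero_of_isZero_right (M := bimod ρ star) (isZero_zero _) _).symm

lemma id_eq_sum_of_addClosure_eq {C : Type*} [Category* C] [Preadditive C]
    [HasFiniteBiproducts C] {P X : C} (hX : addClosure (fun Y => Y = P) X) :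
    ∃ (n : ℕ) (k : Fin n → (X ⟶ P)) (h : Fin n → (P ⟶ X)), ∑ i, k i ≫ h i = 𝟙 X := by
  obtain ⟨n, Z, hZ, ⟨r⟩⟩ := hX
  obtain rfl : Z = fun _ => P := funext hZ
  refine ⟨n, fun i => r.i ≫ biproduct.π (fun _ : Fin n => P) i,
    fun i => biproduct.ι (fun _ : Fin n => P) i ≫ r.r, ?_⟩
  calc ∑ i, (r.i ≫ biproduct.π (fun _ : Fin n => P) i) ≫ biproduct.ι (fun _ : Fin n => P) i ≫ r.r
      = r.i ≫ (∑ i, biproduct.π (fun _ : Fin n => P) i ≫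
          biproduct.ι (fun _ : Fin n => P) i) ≫ r.r := by
        simp only [Preadditive.sum_comp, Preadditive.comp_sum, Category.assoc]
    _ = 𝟙 X := by rw [biproduct.total, Category.id_comp, r.retract]

lemma starObj_generatesT : GeneratesT (starObj ρ star) :=
  GeneratesT.of_t fun t => by
    obtain ⟨n, k, h, e⟩ := id_eq_sum_of_addClosure_eq t.property
    refine ⟨n, fun i => ObjectProperty.homMk (k i), fun i => ObjectProperty.homMk (h i), ?_⟩
    apply ObjectProperty.hom_ext
    exact e.symm.trans ((ObjectProperty.ι _).map_sum
      (fun i => (ObjectProperty.homMk (k i) : t ⟶ (starObj ρ star).t) ≫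
        ObjectProperty.homMk (h i)) Finset.univ).symm

/-- A vertex other than `star` as an object of `U`. -/
def vertexU {q : Q} (hq : q ≠ star) : CatU ρ star :=
  ⟨vertex ρ q, 1, fun _ => vertex ρ q, fun _ => ⟨q, hq, rfl⟩,
    ⟨⟨biproduct.ι (fun _ : Fin 1 => vertex ρ q) 0,
      biproduct.π (fun _ : Fin 1 => vertex ρ q) 0, by simp⟩⟩⟩

/-- The restricted module is `u ↦ C(*, u)`, and unique expansion says that the arrows leaving `*`
form a basis of it. -/
lemma projective_restr_starObj [Fintype (Σ x : Q, star ⟶ x)]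
    (hstar : ∀ a : Q, IsEmpty (a ⟶ star)) (hρ : ∀ b, ρ star b = ∅) :
    Projective ((restr ρ star).obj (representable K (starObj ρ star))) := by
  have hne (α : Σ x : Q, star ⟶ x) : α.1 ≠ star := by
    intro h
    exact (hstar star).false (cast (congrArg _ h) α.2)
  let R := (restr ρ star).obj (representable K (starObj ρ star))
  -- The middle matrix entry identifies the value at `u` with `C(*, u)`: the other two entries have
  -- a zero target or a zero source.
  let m (u : CatU ρ star) : R.obj.obj u →+ (vertex ρ star ⟶ u.obj) :=
    (AddMonoidHom.fst _ _).comp (AddMonoidHom.snd _ _)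
  have hm (u : CatU ρ star) : Function.Bijective (m u) := by
    constructor
    · intro x y h
      exact TriMat.hom_ext ((isZero_zero _).eq_of_tgt _ _) h ((isZero_zero _).eq_of_src _ _)
    · intro f
      exact ⟨(0, f, 0), rfl⟩
  let x (α : Σ x : Q, star ⟶ x) : R.obj.obj (vertexU ρ (hne α)) := (0, arrow ρ α.2, 0)
  have hmx (u : CatU ρ star) (α : Σ x : Q, star ⟶ x) (g : vertexU ρ (hne α) ⟶ u) :
      m u (act R g (x α)) = arrow ρ α.2 ≫ g.hom := by
    exact TriMat.comp_inclU_map (M := bimod ρ star) (A := starObj ρ star) (x α) g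
  refine projective_of_basis R (fun α => vertexU ρ (hne α)) x fun u => ?_
  have hu : HasUniqueExpansion ρ star u.obj := HasUniqueExpansion.of_addClosure
    (by rintro _ ⟨q, hq, rfl⟩; exact hasUniqueExpansion_vertex hρ hq) u.property
  rw [← Function.Bijective.of_comp_iff' (hm u)]
  have : (fun g : (∀ α : (Σ x : Q, star ⟶ x), vertexU ρ (hne α) ⟶ u) =>
      m u (∑ α, act R (g α) (x α))) = (fun g => ∑ α, arrow ρ α.2 ≫ g α) ∘ fun g α => (g α).hom := by
    funext g
    simp only [map_sum, hmx]
    rfl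
  change Function.Bijective (fun g : (∀ α : (Σ x : Q, star ⟶ x), vertexU ρ (hne α) ⟶ u) =>
      m u (∑ α, act R (g α) (x α)))
  rw [this]
  refine hu.comp ⟨fun g g' h => funext fun α => ?_, fun g => ⟨fun α => ObjectProperty.homMk (g α),
    rfl⟩⟩
  exact ObjectProperty.hom_ext _ (congrFun h α)

end Main

end

end OnePointExt

theorem mainTheorem6 {K : Type u} [Field K] {Q : Type u} [Quiver.{u} Q]
    (hQ : OnePointExt.IsStronglyLocallyFinite Q)
    (star : Q) (hstar : ∀ a : Q, IsEmpty (a ⟶ star))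
    (ρ : ∀ a b : Q, Set (Quiver.Path a b →₀ K)) (hρ : OnePointExt.IsRelationSet ρ)
    (hρstar : ∀ b : Q, ρ star b = ∅)
    (X Y : OnePointExt.Mod K (OnePointExt.Lam ρ star))
    (hX : OnePointExt.IsFinPres X) (hY : OnePointExt.IsFinPres Y) :
    Function.Surjective ((OnePointExt.restr ρ star).mapExtLinearMap K X Y 1) ∧
    (∀ j : ℕ, 2 ≤ j →
      Function.Bijective ((OnePointExt.restr ρ star).mapExtLinearMap K X Y j)) ∧
    (OnePointExt.rightPerp (OnePointExt.simpleS ρ star) Y →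
      Function.Bijective ((OnePointExt.restr ρ star).mapExtLinearMap K X Y 1)) := by
  -- Local finiteness makes the basis of arrows leaving `star` finite.
  have := hQ.finite_out star
  have := Fintype.ofFinite (Σ x : Q, star ⟶ x)
  have := OnePointExt.projective_restr_starObj ρ hstar hρstar
  have hs := OnePointExt.starObj_generatesT ρ (star := star)
  have hend := OnePointExt.starObj_end ρ hstar
  exact ⟨OnePointExt.mapExt_restrict_surjective hs hend X Y le_rfl,
    fun j hj => OnePointExt.mapExt_restrict_bijective hs hend X Y hj,
    fun h => OnePointExt.mapExt_restrict_bijective_one hs hend (isZero_zero _) X Y h.2.2⟩
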